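/- **Setting.** There are $k$ arms, a horizon $T\in\mathbb N$, and a connectivity matrix $\mathbf G\in\{0,1\}^{k\times k}$ with $\mathbf G_{i,i}=1$ for all $i$ (not necessarily symmetric). Each arm $i$ has reward distributions $(\nu_{i,n})_{n\ge 1}$ on $\mathbb R$ with means $\mu_i(n)$. If arm $I_t$ is played at round $t$, the observed reward $X_t$ has, given the past and $I_t$, the law $\nu_{I_t,\widetilde N_{I_t,t}}$, where $\widetilde N_{i,t}=\sum_{\tau\le t}\mathbf G_{I_\tau,i}$. With $\gamma_i(n)=\mu_i(n+1)-\mu_i(n)$, the instance $(\boldsymbol\nu,\mathbf G,T)$ is a *stochastic Rising GTB* with proxy $\sigma\ge0$ if, for trigger counts in $\{1,\dots,T\}$, $\mu_i(n)\in[0,1]$, $X-\mu_i(n)$ is $\sigma^2$-subgaussian for $X\sim\nu_{i,n}$, and $\gamma_i\ge 0$ is non-increasing. A (possibly randomized) policy $\pi$ chooses $I_t$ from the past arms and rewards; $J(\pi)=\mathbb E\big[\sum_{t=1}^T\mu_{I_t}(\widetilde N_{I_t,t})\big]$, and the expected regret is $R_{\boldsymbol\nu,\mathbf G,T}(\pi)=\sup_{\pi'}J(\pi')-J(\pi)$.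 Put $$\Upsilon_{\boldsymbol\nu}(M,q)=\sum_{n=1}^{M-1}\max_{i}\gamma_i(n)^q,\qquad \bar k_1=\Big|\Big\{i:\textstyle\sum_j \mathbf G_{j,i}=1\Big\}\Big| .$$ **Algorithm.** Let $N_{i,t-1}$ be the number of pulls of $i$ before round $t$, let $X_{i,(l)}$ be the reward of its $l$-th pull, and let $h=h_{i,t}=\lfloor\epsilon N_{i,t-1}\rfloor$, $\delta_t=t^{-\alpha}$. At every round $t$, R-$\square$-UCB with parameters $\sigma,\epsilon,\alpha$ plays an arm (ties broken arbitrarily) of largest index, the index being $+\infty$ if $h=0$ and otherwise $$\frac1h\sum_{l=N_{i,t-1}-h+1}^{N_{i,t-1}}\Big(X_{i,(l)}+(t-l)\frac{X_{i,(l)}-X_{i,(l-h)}}{h}\Big)+\sigma\,(t-N_{i,t-1}+h-1)\sqrt{\frac{10\log(1/\delta_t)}{h^3}} .$$ **Super-matrix.** A block super-matrix of $\mathbf G$ is a matrix $\mathbf G^U\ge\mathbf G$ (entrywise) for which there is a partition of the arms into cliques such that $\mathbf G^U_{i,j}=1$ if $i,j$ are in the same clique and $\mathbf G^U_{i,j}=0$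 otherwise. It is minimal if it has the largest possible number of cliques. **Theorem.** There is an absolute constant $p\in\mathbb N$ such that for all $\epsilon\in(0,1/2)$ and $\alpha>2$ there is a constant $C=C(\epsilon,\alpha)>0$ such that, for every $k$, $T$, $\sigma\ge 0$, every stochastic Rising GTB $(\boldsymbol\nu,\mathbf G,T)$ with proxy $\sigma$, and every minimal block super-matrix $\bar{\mathbf G}^U$ of $\mathbf G$, with set of cliques $\mathcal C$, R-$\square$-UCB satisfies $$R_{\boldsymbol\nu,\mathbf G,T}\le C\,(1+\log T)^p\Big(k+\inf_{q\in[0,1]}\Big\{k\,(\sigma T)^{2/3}+T^q\,\bar k_1\,\Upsilon_{\boldsymbol\nu}\Big(\Big\lceil\tfrac{T}{\bar k_1}\Big\rceil,q\Big)+T^{\frac{2q}{1+q}}\sum_{D\in\mathcal C}|D|\,\Upsilon_{\boldsymbol\nu}\Big(\Big\lceil\tfrac{T}{|D|}\Big\rceil,q\Big)^{\frac1{1+q}}\Big\}\Big),$$ where the term with $\bar k_1$ is $0$ if $\bar k_1=0$ and $\log T$ is read as $0$ if $T=0$. -/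

import Mathlib

open MeasureTheory ProbabilityTheory Finset
open scoped NNReal

noncomputable section

namespace GTB

/-- Histories of the first `t` rounds with `k` arms: index `s : Fin t` stands for round `s + 1` and
carries the pair (arm played, reward observed). -/
abbrev Hist (k t : ℕ) : Type := Fin t → Fin k × ℝ

/-- A (possibly randomized) policy: given the history of the first `t` rounds, a distribution of
the arm played in round `t + 1`. -/
structure Policy (k : ℕ) where
  act : (t : ℕ) → Kernel (Hist k t) (Fin k)
  markov : ∀ t, IsMarkovKernel (act t)

/-- Number of triggers of arm `i` during the rounds of `h`. -/
def triggers {k t : ℕ} (G : Matrix (Fin k) (Fin k) ℕ) (h : Hist k t) (i : Fin k) : ℕ :=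
  ∑ s : Fin t, G (h s).1 i

/-- Number of pulls of arm `i` during the rounds of `h`. -/
def pulls {k t : ℕ} (h : Hist k t) (i : Fin k) : ℕ :=
  (univ.filter fun s : Fin t => (h s).1 = i).card

theorem measurable_triggers {k t : ℕ} (G : Matrix (Fin k) (Fin k) ℕ) :
    Measurable fun p : Hist k t × Fin k => (p.2, triggers G p.1 p.2 + G p.2 p.2) := by
  refine measurable_snd.prodMk (Measurable.add ?_ ?_)
  · refine Finset.measurable_sum _ fun s _ => ?_
    have h1 : Measurable fun p : Hist k t × Fin k => ((p.1 s).1, p.2) := by fun_prop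
    exact (measurable_of_countable fun q : Fin k × Fin k => G q.1 q.2).comp h1
  · exact (measurable_of_countable fun j : Fin k => G j j).comp measurable_snd

/-- Law of the reward observed when arm `i` is played after history `h`: it is `ν i n`, where `n` is
the number of triggers of `i`, the one caused by the current pull included. -/
def rewardKernel {k : ℕ} (ν : Fin k → ℕ → Measure ℝ) (G : Matrix (Fin k) (Fin k) ℕ) (t : ℕ) :
    Kernel (Hist k t × Fin k) ℝ where
  toFun p := ν p.2 (triggers G p.1 p.2 + G p.2 p.2)
  measurable' :=
    (measurable_of_countable fun q : Fin k × ℕ => ν q.1 q.2).comp (measurable_triggers G)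

/-- Law of the history of the first `t` rounds when `π` is run. -/
def histLaw {k : ℕ} (ν : Fin k → ℕ → Measure ℝ) (G : Matrix (Fin k) (Fin k) ℕ) (π : Policy k) :
    (t : ℕ) → Measure (Hist k t)
  | 0 => Measure.dirac Fin.elim0
  | t + 1 => (((histLaw ν G π t).compProd (π.act t)).compProd (rewardKernel ν G t)).map
      fun p => Fin.snoc (α := fun _ => Fin k × ℝ) p.1.1 (p.1.2, p.2)

/-- Expected reward `μ_i(n)`. -/
def mean {k : ℕ} (ν : Fin k → ℕ → Measure ℝ) (i : Fin k) (n : ℕ) : ℝ := ∫ x, x ∂(ν i n)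

/-- Increment `γ_i(n) = μ_i(n+1) - μ_i(n)`. -/
def incr {k : ℕ} (ν : Fin k → ℕ → Measure ℝ) (i : Fin k) (n : ℕ) : ℝ :=
  mean ν i (n + 1) - mean ν i n

/-- Number of triggers, up to and including the round of index `s`, of the arm played in that
round. -/
def internalTime {k t : ℕ} (G : Matrix (Fin k) (Fin k) ℕ) (h : Hist k t) (s : Fin t) : ℕ :=
  ∑ r ∈ univ.filter (fun r : Fin t => r ≤ s), G (h r).1 (h s).1

/-- Expected cumulative reward `J` of a policy over `T` rounds. -/
def value {k : ℕ} (ν : Fin k → ℕ → Measure ℝ) (G : Matrix (Fin k) (Fin k) ℕ) (T : ℕ)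
    (π : Policy k) : ℝ :=
  ∫ h, ∑ s : Fin T, mean ν (h s).1 (internalTime G h s) ∂(histLaw ν G π T)

/-- Expected policy regret over `T` rounds. -/
def regret {k : ℕ} (ν : Fin k → ℕ → Measure ℝ) (G : Matrix (Fin k) (Fin k) ℕ) (T : ℕ)
    (π : Policy k) : ℝ :=
  (⨆ π' : Policy k, value ν G T π') - value ν G T π

/-- `(ν, G, T)` is an instance of a rising graph-triggered bandit with subgaussianity proxy `σ`.
The graph may be directed; only the values `n = 1, …, T` of the trigger counter matter. -/
structure IsRising {k : ℕ} (ν : Fin k → ℕ → Measure ℝ) (G : Matrix (Fin k) (Fin k) ℕ) (T : ℕ)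
    (σ : ℝ≥0) : Prop where
  entries : ∀ i j, G i j = 0 ∨ G i j = 1
  diag : ∀ i, G i i = 1
  mean_mem : ∀ i n, 1 ≤ n → n ≤ T → mean ν i n ∈ Set.Icc (0 : ℝ) 1
  subgaussian : ∀ i n, 1 ≤ n → n ≤ T →
    HasSubgaussianMGF (fun x => x - mean ν i n) (σ ^ 2) (ν i n)
  nondecreasing : ∀ i n, 1 ≤ n → n < T → 0 ≤ incr ν i n
  concave : ∀ i n, 1 ≤ n → n + 1 < T → incr ν i (n + 1) ≤ incr ν i n

/-- Total increment `Υ(M, q) = ∑_{n=1}^{M-1} max_i γ_i(n)^q`. -/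
def totalIncrement {k : ℕ} (ν : Fin k → ℕ → Measure ℝ) (M : ℕ) (q : ℝ) : ℝ :=
  ∑ n ∈ Finset.Ico 1 M, ⨆ i : Fin k, incr ν i n ^ q

/-- Number of arms of degree one, where the degree of `i` is the sum of column `i` of `G`. -/
def degOneCount {k : ℕ} (G : Matrix (Fin k) (Fin k) ℕ) : ℕ :=
  (univ.filter fun i : Fin k => ∑ j, G j i = 1).card

/-- The block-diagonal connectivity matrix (cluster graph) whose cliques are the parts of `P`. -/
def blockMatrix {k : ℕ} (P : Finpartition (univ : Finset (Fin k))) : Matrix (Fin k) (Fin k) ℕ :=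
  fun i j => if P.part i = P.part j then 1 else 0

/-- `P` is the set of cliques of a block super-matrix of `G`. -/
def IsSuper {k : ℕ} (G : Matrix (Fin k) (Fin k) ℕ)
    (P : Finpartition (univ : Finset (Fin k))) : Prop :=
  ∀ i j, G i j ≤ blockMatrix P i j

/-- `P` is the set of cliques of a minimal block super-matrix of `G`: one with the largest number
of cliques. -/
def IsMinimalSuper {k : ℕ} (G : Matrix (Fin k) (Fin k) ℕ)
    (P : Finpartition (univ : Finset (Fin k))) : Prop :=
  IsSuper G P ∧ ∀ Q, IsSuper G Q → Q.parts.card ≤ P.parts.card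

/-- Reward observed at the `l`-th pull of arm `i` (`l = 1, …, pulls h i`). -/
def nthReward {k t : ℕ} (h : Hist k t) (i : Fin k) (l : ℕ) : ℝ :=
  ∑ s : Fin t, if (h s).1 = i ∧ (univ.filter fun r : Fin t => r ≤ s ∧ (h r).1 = i).card = l
    then (h s).2 else 0

/-- The window `⌊ε N⌋` with `N` the number of pulls of `i`. -/
def window {k t : ℕ} (ε : ℝ) (h : Hist k t) (i : Fin k) : ℕ := ⌊ε * (pulls h i : ℝ)⌋₊

/-- The estimator of arm `i` with window `w` for the round `t + 1` following the history `h`. -/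
def estimator {k t : ℕ} (w : ℕ) (h : Hist k t) (i : Fin k) : ℝ :=
  (1 / (w : ℝ)) * ∑ l ∈ Finset.Icc (pulls h i - w + 1) (pulls h i),
    (nthReward h i l +
      (((t + 1 : ℕ) : ℝ) - l) * ((nthReward h i l - nthReward h i (l - w)) / w))

/-- The exploration bonus of arm `i` with window `w` and confidence `δ`, for round `t + 1`. -/
def bonus {k t : ℕ} (σ : ℝ≥0) (w : ℕ) (δ : ℝ) (h : Hist k t) (i : Fin k) : ℝ :=
  σ * (((t + 1 : ℕ) : ℝ) - pulls h i + w - 1) * √(10 * Real.log (1 / δ) / (w : ℝ) ^ 3)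

/-- Optimistic index for round `t + 1`, with `δ = (t + 1) ^ (-α)`; it is `+∞` as long as the window
is empty. -/
def ucb {k t : ℕ} (σ : ℝ≥0) (ε α : ℝ) (h : Hist k t) (i : Fin k) : EReal :=
  if window ε h i = 0 then ⊤
  else ((estimator (window ε h i) h i +
    bonus σ (window ε h i) (((t + 1 : ℕ) : ℝ) ^ (-α)) h i : ℝ) : EReal)

/-- `π` is R-□-UCB: in every round it plays an arm of maximal index (ties broken arbitrarily,
possibly at random). -/
def IsRBoxUCB {k : ℕ} (σ : ℝ≥0) (ε α : ℝ) (π : Policy k) : Prop :=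
  ∀ (t : ℕ) (h : Hist k t), ∀ᵐ i ∂(π.act t h), ∀ j, ucb σ ε α h j ≤ ucb σ ε α h i

end GTB

end

/-!
The regret of a policy is compared, round by round, with the largest mean `max_j μ_j(t)` that any
arm could have if all `t` rounds had triggered it; no policy earns more (`value_le_oracleValue`).

*Concentration.* For a fixed arm and a fixed number of its pulls, the estimator is a fixed linear
combination of the rewards of these pulls. Its noise is controlled by an exponential supermartingale
along the history (`lintegral_expWeight_le`), and the exploration bonus is exactly the resulting
subgaussian deviation at confidence `t ^ (-α)`. A union bound over arms and numbers of pulls gives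
probability `O(k t ^ (1 - α))` to a deviation in round `t` (`histLaw_deviationSet_le`), which is
summable as `α > 2`.

*One round.* Let the arm `i` played in a round without deviation have `N` earlier pulls and window
`w ≈ ε N`. By concavity, and since an arm is triggered at least as often as it is pulled,
extrapolating the means overestimates `μ_j(t)` for every `j` (`mean_le_extrapolate`), with a bias of
at most `T² γ_i(n) / w` for any `n` that precedes the window (`extrapolate_le`). So the regret of the
round is at most `min 1 (T² γ_i(n) / w) + min 1 (2 bonus)`. In the first summand,
`min 1 x ≤ x ^ (q / (1 + q))` and `γ_i(n) ^ q ≤ Υ(M, q) / n` for `n < M` (monotone increments); taking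
for `n` the smaller of about `(1 - 2 ε) N` and `M - 1`, with `M = ⌈T / |D|⌉` and `D` the clique of
`i`, bounds it by a constant times `T ^ (2 q / (1 + q)) Υ(M, q) ^ (1 / (1 + q)) (1 / N + 1 / M)`
(`min_one_bias_le`). In the second summand, `min 1 x ≤ x ^ (2 / 3)` gives a multiple of
`(σ T) ^ (2 / 3) / N` up to a logarithm (`min_one_bonus_le`).

*Summation.* Over the pulls of an arm, `1 / N` sums to at most `1 + log T`; over the rounds spent in
`D`, the term `1 / M` sums to at most `T / M ≤ |D|` (`oracleValue_le`). The cliques alone thus account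
for the whole regret, and the term of the arms of degree one enters only through its nonnegativity.
-/

noncomputable section

namespace GTB

variable {k t T : ℕ}

/-! ### Combinatorics of histories -/

/-- The first `t` rounds of a history of `T` rounds. -/
def truncate (hle : t ≤ T) (h : Hist k T) : Hist k t := fun r => h (Fin.castLE hle r)

/-- Number of pulls of `i` during the rounds of index at most `s`; if `i` is played in the round of
index `s`, that round is the `pullIndex h i s`-th pull of `i`. -/
def pullIndex (h : Hist k t) (i : Fin k) (s : Fin t) : ℕ :=
  (univ.filter fun r : Fin t => r ≤ s ∧ (h r).1 = i).card

theorem sum_filter_le {M : Type*} [AddCommMonoid M] (s : Fin t) (f : Fin t → M) :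
    ∑ r ∈ univ.filter (fun r : Fin t => r ≤ s), f r =
      ∑ r : Fin s, f (Fin.castLE s.isLt.le r) + f s := by
  have h1 : univ.filter (fun r : Fin t => r ≤ s) =
      insert s (univ.filter (fun r : Fin t => r < s)) := by
    ext r; simp [le_iff_eq_or_lt]
  rw [h1, sum_insert (by simp), add_comm]
  congr 1
  symm
  refine Finset.sum_bij (fun r _ => Fin.castLE s.isLt.le r) ?_ ?_ ?_ ?_
  · intro r _; exact mem_filter.2 ⟨mem_univ _, r.2⟩
  · intro a _ b _ hab; simpa [Fin.ext_iff] using hab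
  · intro b hb
    exact ⟨⟨b, (mem_filter.1 hb).2⟩, mem_univ _, rfl⟩
  · intros; rfl

theorem pulls_eq_sum (h : Hist k t) (i : Fin k) :
    pulls h i = ∑ s : Fin t, if (h s).1 = i then 1 else 0 := by
  rw [pulls, card_filter]

theorem pullIndex_eq_sum (h : Hist k t) (i : Fin k) (s : Fin t) :
    pullIndex h i s =
      ∑ r ∈ univ.filter (fun r : Fin t => r ≤ s), if (h r).1 = i then 1 else 0 := by
  rw [pullIndex, ← filter_filter, card_filter]

theorem pullIndex_eq (h : Hist k t) (i : Fin k) (s : Fin t) :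
    pullIndex h i s = pulls (truncate s.isLt.le h) i + if (h s).1 = i then 1 else 0 := by
  rw [pullIndex_eq_sum, sum_filter_le, pulls_eq_sum]; rfl

theorem internalTime_eq (G : Matrix (Fin k) (Fin k) ℕ) (h : Hist k t) (s : Fin t) :
    internalTime G h s =
      triggers G (truncate s.isLt.le h) (h s).1 + G (h s).1 (h s).1 := by
  rw [internalTime, sum_filter_le]; rfl

theorem truncate_snoc (h : Hist k t) (x : Fin k × ℝ) (hle : t ≤ t + 1) :
    truncate hle (Fin.snoc (α := fun _ => Fin k × ℝ) h x) = h := by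
  funext r
  exact Fin.snoc_castSucc (α := fun _ => Fin k × ℝ) x h r

theorem pullIndex_truncate (hle : t ≤ T) (h : Hist k T) (i : Fin k) (s : Fin t) :
    pullIndex (truncate hle h) i s = pullIndex h i (Fin.castLE hle s) := by
  rw [pullIndex_eq, pullIndex_eq]; rfl

theorem internalTime_truncate (G : Matrix (Fin k) (Fin k) ℕ) (hle : t ≤ T) (h : Hist k T)
    (s : Fin t) : internalTime G (truncate hle h) s = internalTime G h (Fin.castLE hle s) := by
  rw [internalTime_eq, internalTime_eq]; rfl

theorem pullIndex_strictMono (h : Hist k t) (i : Fin k) {s s' : Fin t} (hs : s < s')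
    (h' : (h s').1 = i) : pullIndex h i s < pullIndex h i s' := by
  refine card_lt_card (Finset.ssubset_iff_of_subset ?_ |>.2 ⟨s', ?_, ?_⟩)
  · intro r hr
    simp only [mem_filter, mem_univ, true_and] at hr ⊢
    exact ⟨hr.1.trans hs.le, hr.2⟩
  · simp [h']
  · simp [hs]

theorem pullIndex_injOn (h : Hist k t) (i : Fin k) {s s' : Fin t} (h1 : (h s).1 = i)
    (h2 : (h s').1 = i) (he : pullIndex h i s = pullIndex h i s') : s = s' := by
  rcases lt_trichotomy s s' with hl | hl | hl
  · exact absurd he (pullIndex_strictMono h i hl h2).ne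
  · exact hl
  · exact absurd he (pullIndex_strictMono h i hl h1).ne'

theorem one_le_pullIndex (h : Hist k t) (i : Fin k) {s : Fin t} (h1 : (h s).1 = i) :
    1 ≤ pullIndex h i s := by
  rw [pullIndex_eq, if_pos h1]; omega

theorem pullIndex_le_pulls (h : Hist k t) (i : Fin k) (s : Fin t) :
    pullIndex h i s ≤ pulls h i := by
  refine card_le_card fun r hr => ?_
  simp only [mem_filter, mem_univ, true_and] at hr ⊢
  exact hr.2

theorem pulls_le (h : Hist k t) (i : Fin k) : pulls h i ≤ t := by
  simpa [pulls] using card_filter_le (univ : Finset (Fin t)) fun s => (h s).1 = i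

theorem exists_pullIndex_eq (h : Hist k t) (i : Fin k) {l : ℕ} (h1 : 1 ≤ l)
    (h2 : l ≤ pulls h i) : ∃ s, (h s).1 = i ∧ pullIndex h i s = l := by
  -- the pull indices of the pulls of `i` are distinct elements of `{1, …, pulls h i}`,
  -- hence exhaust this set
  have himg : (univ.filter fun s : Fin t => (h s).1 = i).image (pullIndex h i) =
      Finset.Icc 1 (pulls h i) := by
    refine eq_of_subset_of_card_le ?_ ?_
    · intro l hl
      obtain ⟨s, hs, rfl⟩ := mem_image.1 hl
      have hs' : (h s).1 = i := (mem_filter.1 hs).2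
      exact mem_Icc.2 ⟨one_le_pullIndex h i hs', pullIndex_le_pulls h i s⟩
    · rw [card_image_of_injOn]
      · simp [pulls]
      · intro a ha b hb hab
        exact pullIndex_injOn h i (mem_filter.1 ha).2 (mem_filter.1 hb).2 hab
  have : l ∈ (univ.filter fun s : Fin t => (h s).1 = i).image (pullIndex h i) := by
    rw [himg]; exact mem_Icc.2 ⟨h1, h2⟩
  obtain ⟨s, hs, hl⟩ := mem_image.1 this
  exact ⟨s, (mem_filter.1 hs).2, hl⟩

/-- Between two pulls of an arm, its trigger counter grows at least as much as its pull counter. -/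
theorem internalTime_add_le {G : Matrix (Fin k) (Fin k) ℕ} (hd : ∀ i, G i i = 1)
    (h : Hist k t) (i : Fin k) {s s' : Fin t} (hs : s ≤ s') (h1 : (h s).1 = i)
    (h2 : (h s').1 = i) :
    internalTime G h s + pullIndex h i s' ≤ internalTime G h s' + pullIndex h i s := by
  have hsub : univ.filter (fun r : Fin t => r ≤ s) ⊆ univ.filter (fun r : Fin t => r ≤ s') := by
    intro r hr
    simp only [mem_filter, mem_univ, true_and] at hr ⊢
    exact hr.trans hs
  rw [internalTime, internalTime, pullIndex_eq_sum, pullIndex_eq_sum, h1, h2,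
    ← sum_sdiff hsub, ← sum_sdiff hsub]
  have : ∑ r ∈ univ.filter (fun r : Fin t => r ≤ s') \ univ.filter (fun r : Fin t => r ≤ s),
      (if (h r).1 = i then 1 else 0) ≤
      ∑ r ∈ univ.filter (fun r : Fin t => r ≤ s') \ univ.filter (fun r : Fin t => r ≤ s),
        G (h r).1 i := by
    refine sum_le_sum fun r _ => ?_
    split_ifs with hr
    · rw [hr, hd]
    · exact Nat.zero_le _
  omega

theorem pullIndex_le_internalTime {G : Matrix (Fin k) (Fin k) ℕ} (hd : ∀ i, G i i = 1)
    (h : Hist k t) (i : Fin k) {s : Fin t} (h1 : (h s).1 = i) :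
    pullIndex h i s ≤ internalTime G h s := by
  rw [internalTime, pullIndex_eq_sum, h1]
  refine sum_le_sum fun r _ => ?_
  split_ifs with hr
  · rw [hr, hd]
  · exact Nat.zero_le _

theorem triggers_le {G : Matrix (Fin k) (Fin k) ℕ} (he : ∀ i j, G i j = 0 ∨ G i j = 1)
    (h : Hist k t) (i : Fin k) : triggers G h i ≤ t := by
  calc triggers G h i ≤ ∑ _s : Fin t, 1 :=
        sum_le_sum fun s _ => by rcases he (h s).1 i with h | h <;> omega
    _ = t := by simp

theorem internalTime_le {G : Matrix (Fin k) (Fin k) ℕ} (he : ∀ i j, G i j = 0 ∨ G i j = 1)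
    (h : Hist k t) (s : Fin t) : internalTime G h s ≤ s + 1 := by
  rw [internalTime_eq]
  have h1 := triggers_le he (truncate s.isLt.le h) (h s).1
  rcases he (h s).1 (h s).1 with h | h <;> omega

theorem one_le_internalTime {G : Matrix (Fin k) (Fin k) ℕ} (hd : ∀ i, G i i = 1)
    (h : Hist k t) (s : Fin t) : 1 ≤ internalTime G h s := by
  rw [internalTime_eq, hd]; omega

theorem internalTime_le_triggers (G : Matrix (Fin k) (Fin k) ℕ)
    (h : Hist k t) (s : Fin t) : internalTime G h s ≤ triggers G h (h s).1 := by
  exact sum_le_sum_of_subset (filter_subset _ _)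

/-- The value of `f` at the `l`-th pull of `i` (`0` if there is no such pull). -/
def atPull (h : Hist k t) (i : Fin k) (f : Fin t → ℝ) (l : ℕ) : ℝ :=
  ∑ s : Fin t, if (h s).1 = i ∧ pullIndex h i s = l then f s else 0

theorem nthReward_eq (h : Hist k t) (i : Fin k) :
    nthReward h i = atPull h i fun s => (h s).2 := rfl

theorem atPull_pullIndex (h : Hist k t) (i : Fin k) (f : Fin t → ℝ) {s : Fin t}
    (hs : (h s).1 = i) : atPull h i f (pullIndex h i s) = f s := by
  rw [atPull, Finset.sum_eq_single s]
  · simp [hs]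
  · intro b _ hb
    rw [if_neg]
    rintro ⟨h1, h2⟩
    exact hb (pullIndex_injOn h i h1 hs h2)
  · simp

theorem atPull_sub (h : Hist k t) (i : Fin k) (f g : Fin t → ℝ) (l : ℕ) :
    atPull h i f l - atPull h i g l = atPull h i (fun s => f s - g s) l := by
  simp only [atPull, ← sum_sub_distrib]
  refine sum_congr rfl fun s _ => ?_
  split_ifs <;> simp

/-- A linear combination over the pulls of an arm, as a sum over rounds. -/
theorem sum_mul_atPull (h : Hist k t) (i : Fin k) (f : Fin t → ℝ) (c : ℕ → ℝ) :
    ∑ j ∈ range (pulls h i), c j * atPull h i f (j + 1) =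
      ∑ s : Fin t, if (h s).1 = i then c (pullIndex h i s - 1) * f s else 0 := by
  simp only [atPull, mul_sum]
  rw [sum_comm]
  refine sum_congr rfl fun s _ => ?_
  split_ifs with hs
  · have h1 := one_le_pullIndex h i hs
    have h2 := pullIndex_le_pulls h i s
    rw [Finset.sum_eq_single (pullIndex h i s - 1)]
    · rw [if_pos ⟨hs, by omega⟩]
    · intro b _ hb
      rw [if_neg (by omega), mul_zero]
    · intro hn
      exact absurd (mem_range.2 (by omega)) hn
  · exact sum_eq_zero fun j _ => by simp [hs]

/-- Distinct pulls of an arm have distinct indices, so summing a nonnegative function of the indices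
over the pulls gives at most its sum over `range n`, provided that it vanishes from `n` on or that
`n` is at least the number of rounds. -/
theorem sum_pullIndex_le (h : Hist k t) (i : Fin k) {n : ℕ} (c : ℕ → ℝ) (hc : ∀ l, 0 ≤ c l)
    (hn : ∀ l, n ≤ l → c l = 0 ∨ t ≤ l) :
    ∑ s : Fin t, (if (h s).1 = i then c (pullIndex h i s - 1) else 0) ≤ ∑ l ∈ range n, c l := by
  have h0 := sum_mul_atPull h i (fun _ => 1) c
  simp only [mul_one] at h0
  rw [← h0]
  have h2 := pulls_le h i
  calc ∑ j ∈ range (pulls h i), c j * atPull h i (fun _ => 1) (j + 1)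
      = ∑ j ∈ range (pulls h i), c j := by
        refine sum_congr rfl fun j hj => ?_
        obtain ⟨s, hs, hl⟩ := exists_pullIndex_eq h i (l := j + 1) (by omega)
          (by have := mem_range.1 hj; omega)
        rw [← hl, atPull_pullIndex h i _ hs, mul_one]
    _ ≤ ∑ l ∈ range n, c l := by
        have h3 : ∑ j ∈ range (pulls h i), c j =
            ∑ j ∈ (range (pulls h i)).filter (fun j => j < n), c j := by
          symm
          refine sum_filter_of_ne fun j hj hne => ?_
          by_contra hlt
          have := mem_range.1 hj
          rcases hn j (not_lt.1 hlt) with h | h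
          · exact hne h
          · omega
        rw [h3]
        refine sum_le_sum_of_subset_of_nonneg ?_ fun _ _ _ => hc _
        intro j hj
        exact mem_range.2 (mem_filter.1 hj).2

/-! ### The law of the history -/

theorem isProbabilityMeasure_histLaw {ν : Fin k → ℕ → Measure ℝ}
    (hν : ∀ i n, IsProbabilityMeasure (ν i n)) (G : Matrix (Fin k) (Fin k) ℕ) (π : Policy k) :
    ∀ t, IsProbabilityMeasure (histLaw ν G π t)
  | 0 => by rw [histLaw]; infer_instance
  | t + 1 => by
    have := isProbabilityMeasure_histLaw hν G π t
    have := π.markov t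
    have : IsMarkovKernel (rewardKernel ν G t) := ⟨fun p => hν _ _⟩
    rw [histLaw]
    refine Measure.isProbabilityMeasure_map ?_
    refine Measurable.aemeasurable ?_
    refine measurable_pi_lambda _ fun s => ?_
    refine Fin.lastCases ?_ (fun r => ?_) s
    · simp only [Fin.snoc_last]; fun_prop
    · simp only [Fin.snoc_castSucc]; fun_prop

theorem measurable_snoc : Measurable fun p : (Hist k t × Fin k) × ℝ =>
    (Fin.snoc (α := fun _ => Fin k × ℝ) p.1.1 (p.1.2, p.2) : Hist k (t + 1)) := by
  refine measurable_pi_lambda _ fun s => ?_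
  refine Fin.lastCases ?_ (fun r => ?_) s
  · simp only [Fin.snoc_last]; fun_prop
  · simp only [Fin.snoc_castSucc]; fun_prop

theorem measurable_truncate (hle : t ≤ T) : Measurable (truncate (k := k) hle) := by
  unfold truncate; fun_prop

theorem lintegral_histLaw_succ {ν : Fin k → ℕ → Measure ℝ}
    (hν : ∀ i n, IsProbabilityMeasure (ν i n)) (G : Matrix (Fin k) (Fin k) ℕ) (π : Policy k)
    {f : Hist k (t + 1) → ENNReal} (hf : Measurable f) :
    ∫⁻ h, f h ∂(histLaw ν G π (t + 1)) =
      ∫⁻ h, ∫⁻ i, ∫⁻ x, f (Fin.snoc (α := fun _ => Fin k × ℝ) h (i, x))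
        ∂(ν i (triggers G h i + G i i)) ∂(π.act t h) ∂(histLaw ν G π t) := by
  have := isProbabilityMeasure_histLaw hν G π t
  have := π.markov t
  have : IsMarkovKernel (rewardKernel ν G t) := ⟨fun p => hν _ _⟩
  have hf' : Measurable fun p : (Hist k t × Fin k) × ℝ =>
      f (Fin.snoc (α := fun _ => Fin k × ℝ) p.1.1 (p.1.2, p.2)) := hf.comp measurable_snoc
  rw [histLaw, lintegral_map hf measurable_snoc, Measure.lintegral_compProd hf',
    Measure.lintegral_compProd (Measurable.lintegral_kernel_prod_right' hf')]
  rfl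

/-- The first `t` rounds of the interaction over `T` rounds are the interaction over `t` rounds. -/
theorem histLaw_map_truncate {ν : Fin k → ℕ → Measure ℝ}
    (hν : ∀ i n, IsProbabilityMeasure (ν i n)) (G : Matrix (Fin k) (Fin k) ℕ) (π : Policy k)
    (hle : t ≤ T) : (histLaw ν G π T).map (truncate hle) = histLaw ν G π t := by
  induction T, hle using Nat.le_induction with
  | base => exact Measure.map_id
  | succ n hn ih =>
    have := isProbabilityMeasure_histLaw hν G π n
    have := π.markov n
    have : IsMarkovKernel (rewardKernel ν G n) := ⟨fun p => hν _ _⟩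
    have h1 : truncate (k := k) (hn.trans n.le_succ) =
        truncate hn ∘ truncate (k := k) n.le_succ := rfl
    rw [h1, ← Measure.map_map (measurable_truncate _) (measurable_truncate _)]
    suffices (histLaw ν G π (n + 1)).map (truncate n.le_succ) = histLaw ν G π n by rw [this, ih]
    rw [histLaw, Measure.map_map (measurable_truncate _) measurable_snoc]
    have h2 : (truncate (k := k) n.le_succ ∘ fun p : (Hist k n × Fin k) × ℝ =>
        (Fin.snoc (α := fun _ => Fin k × ℝ) p.1.1 (p.1.2, p.2) : Hist k (n + 1))) =
        Prod.fst ∘ Prod.fst := by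
      funext p
      exact truncate_snoc _ _ _
    rw [h2, ← Measure.map_map measurable_fst measurable_fst]
    change Measure.fst (Measure.fst _) = _
    rw [Measure.fst_compProd, Measure.fst_compProd]

/-- Almost surely, an R-□-UCB policy plays an arm of maximal index in every round. -/
theorem ae_ucb_le {ν : Fin k → ℕ → Measure ℝ} (hν : ∀ i n, IsProbabilityMeasure (ν i n))
    (G : Matrix (Fin k) (Fin k) ℕ) {π : Policy k} {σ : ℝ≥0} {ε α : ℝ}
    (hπ : IsRBoxUCB σ ε α π) (s : Fin T) :
    ∀ᵐ h ∂(histLaw ν G π T), ∀ j,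
      ucb σ ε α (truncate s.isLt.le h) j ≤ ucb σ ε α (truncate s.isLt.le h) (h s).1 := by
  -- arms of positive probability are maximizers; this avoids measurability of the index
  have hmeas : Measurable fun p : Hist k s × Fin k => π.act s p.1 {p.2} :=
    measurable_from_prod_countable_left fun i =>
      (π.act s).measurable_coe (measurableSet_singleton i)
  have hN : MeasurableSet {p : Hist k s × Fin k | π.act s p.1 {p.2} = 0} :=
    hmeas (measurableSet_singleton 0)
  set S : Set (Hist k (s + 1)) :=
    {h | π.act s (truncate s.val.le_succ h) {(h (Fin.last s)).1} = 0} with hS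
  have hSm : MeasurableSet S := by
    have : Measurable fun h : Hist k (s + 1) =>
        (truncate s.val.le_succ h, (h (Fin.last s)).1) :=
      (measurable_truncate _).prodMk (by fun_prop)
    exact this hN
  have h0 : histLaw ν G π (s + 1) S = 0 := by
    rw [← lintegral_indicator_one hSm, lintegral_histLaw_succ hν G π
      (measurable_one.indicator hSm)]
    refine (lintegral_congr fun h => ?_).trans lintegral_zero
    have := π.markov s
    rw [lintegral_fintype]
    refine sum_eq_zero fun i _ => ?_
    by_cases hi : π.act s h {i} = 0
    · rw [hi, mul_zero]
    · refine mul_eq_zero_of_left ((lintegral_congr fun x => ?_).trans lintegral_zero) _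
      refine Set.indicator_of_notMem ?_ _
      simp only [hS, Set.mem_ofPred_eq, truncate_snoc, Fin.snoc_last]
      exact hi
  have h1 : histLaw ν G π T (truncate (Nat.succ_le_of_lt s.isLt) ⁻¹' S) = 0 := by
    rw [← Measure.map_apply (measurable_truncate _) hSm, histLaw_map_truncate hν, h0]
  filter_upwards [measure_eq_zero_iff_ae_notMem.1 h1] with h hh
  have h2 : π.act s (truncate s.isLt.le h) {(h s).1} ≠ 0 := hh
  by_contra hcon
  exact h2 (measure_mono_null (Set.singleton_subset_iff.2 hcon)
    (ae_iff.1 (hπ s (truncate s.isLt.le h))))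

/-! ### Concentration of the rewards -/

/-- Deviation of the reward of the round of index `s` from its conditional expectation. -/
def noise (ν : Fin k → ℕ → Measure ℝ) (G : Matrix (Fin k) (Fin k) ℕ) (h : Hist k t)
    (s : Fin t) : ℝ := (h s).2 - mean ν (h s).1 (internalTime G h s)

/-- Exponential supermartingale of the noise of arm `i`, the noise of its `(j + 1)`-st pull being
weighted by `c j`. -/
def expWeight (ν : Fin k → ℕ → Measure ℝ) (G : Matrix (Fin k) (Fin k) ℕ) (σ : ℝ≥0) (i : Fin k)
    (c : ℕ → ℝ) (h : Hist k t) : ℝ :=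
  Real.exp (∑ s : Fin t, if (h s).1 = i then
    c (pullIndex h i s - 1) * noise ν G h s - σ ^ 2 * c (pullIndex h i s - 1) ^ 2 / 2 else 0)

theorem measurable_of_arms {M : Type*} [MeasurableSpace M] (f : (Fin t → Fin k) → M) :
    Measurable fun h : Hist k t => f fun s => (h s).1 :=
  (measurable_of_countable f).comp (by fun_prop)

theorem measurable_expWeight (ν : Fin k → ℕ → Measure ℝ) (G : Matrix (Fin k) (Fin k) ℕ)
    (σ : ℝ≥0) (i : Fin k) (c : ℕ → ℝ) :
    Measurable (expWeight (t := t) ν G σ i c) := by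
  refine Real.measurable_exp.comp (Finset.measurable_sum _ fun s _ => ?_)
  have h1 : Measurable fun h : Hist k t => pullIndex h i s :=
    measurable_of_arms fun a => (univ.filter fun r : Fin t => r ≤ s ∧ a r = i).card
  have h2 : Measurable fun h : Hist k t => mean ν (h s).1 (internalTime G h s) :=
    measurable_of_arms fun a => mean ν (a s) (∑ r ∈ univ.filter (fun r => r ≤ s), G (a r) (a s))
  have h3 : Measurable fun h : Hist k t => c (pullIndex h i s - 1) :=
    (measurable_of_countable fun n : ℕ => c (n - 1)).comp h1
  have h4 : Measurable fun h : Hist k t => (h s).1 := by fun_prop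
  refine Measurable.ite (h4 (measurableSet_singleton i)) ?_ measurable_const
  unfold noise
  fun_prop

theorem expWeight_snoc (ν : Fin k → ℕ → Measure ℝ) (G : Matrix (Fin k) (Fin k) ℕ)
    (σ : ℝ≥0) (i : Fin k) (c : ℕ → ℝ) (h : Hist k t) (j : Fin k) (x : ℝ) :
    expWeight ν G σ i c (Fin.snoc (α := fun _ => Fin k × ℝ) h (j, x) : Hist k (t + 1)) =
      expWeight ν G σ i c h * if j = i then
        Real.exp (c (pulls h i) * (x - mean ν j (triggers G h j + G j j))
          - σ ^ 2 * c (pulls h i) ^ 2 / 2) else 1 := by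
  set H : Hist k (t + 1) := Fin.snoc (α := fun _ => Fin k × ℝ) h (j, x) with hH
  have ht : truncate t.le_succ H = h := truncate_snoc _ _ _
  have hlast : H (Fin.last t) = (j, x) := Fin.snoc_last ..
  have hc : ∀ s : Fin t, H s.castSucc = h s := fun s =>
    Fin.snoc_castSucc (α := fun _ => Fin k × ℝ) (j, x) h s
  have hp : ∀ s : Fin t, pullIndex H i s.castSucc = pullIndex h i s := fun s => by
    conv_rhs => rw [← ht]
    rw [pullIndex_truncate]; rfl
  have hi : ∀ s : Fin t, internalTime G H s.castSucc = internalTime G h s := fun s => by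
    conv_rhs => rw [← ht]
    rw [internalTime_truncate]; rfl
  have hil : internalTime G H (Fin.last t) = triggers G h j + G j j := by
    have h1 := internalTime_eq G H (Fin.last t)
    have ht' : truncate (Fin.last t).isLt.le H = h := ht
    rw [hlast] at h1
    rw [h1]
    exact congrArg (fun z => triggers G z j + G j j) ht'
  have hpl : j = i → pullIndex H i (Fin.last t) - 1 = pulls h i := by
    intro hji
    have h1 := pullIndex_eq H i (Fin.last t)
    rw [hlast, if_pos hji] at h1
    rw [h1, Nat.add_sub_cancel]
    exact congrArg (fun z => pulls z i) ht
  unfold expWeight noise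
  rw [Fin.sum_univ_castSucc, Real.exp_add]
  simp only [hc, hp, hi, hlast, hil]
  congr 1
  split_ifs with hji
  · rw [hpl hji]
  · exact Real.exp_zero

/-- The exponential weight is a supermartingale started at `1`. -/
theorem lintegral_expWeight_le {ν : Fin k → ℕ → Measure ℝ}
    (hν : ∀ i n, IsProbabilityMeasure (ν i n)) {G : Matrix (Fin k) (Fin k) ℕ} {σ : ℝ≥0}
    (hR : IsRising ν G T σ) (π : Policy k) (i : Fin k) (c : ℕ → ℝ) (ht : t ≤ T) :
    ∫⁻ h, ENNReal.ofReal (expWeight ν G σ i c h) ∂(histLaw ν G π t) ≤ 1 := by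
  induction t with
  | zero =>
    have := isProbabilityMeasure_histLaw hν G π 0
    have h1 : ∀ h : Hist k 0, expWeight ν G σ i c h = 1 := fun h => by simp [expWeight]
    simp [h1]
  | succ t ih =>
    refine le_trans ?_ (ih (by omega))
    rw [lintegral_histLaw_succ hν G π (measurable_expWeight ν G σ i c).ennreal_ofReal]
    refine lintegral_mono fun h => ?_
    have := π.markov t
    have key : ∀ j, ∫⁻ x, ENNReal.ofReal (expWeight ν G σ i c
        (Fin.snoc (α := fun _ => Fin k × ℝ) h (j, x) : Hist k (t + 1)))
          ∂(ν j (triggers G h j + G j j)) ≤ ENNReal.ofReal (expWeight ν G σ i c h) := by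
      intro j
      have := hν j (triggers G h j + G j j)
      have hpos : 0 ≤ expWeight ν G σ i c h := (Real.exp_pos _).le
      simp only [expWeight_snoc, ENNReal.ofReal_mul hpos]
      rw [lintegral_const_mul' _ _ ENNReal.ofReal_ne_top]
      refine mul_le_of_le_one_right' ?_
      split_ifs with hji
      · have hn := triggers_le hR.entries h j
        have hG := hR.diag j
        have hsub := hR.subgaussian j (triggers G h j + G j j) (by omega) (by omega)
        simp only [Real.exp_sub, div_eq_mul_inv (Real.exp _)]
        simp only [ENNReal.ofReal_mul (Real.exp_pos _).le]
        rw [lintegral_mul_const' _ _ ENNReal.ofReal_ne_top,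
          ← ofReal_integral_eq_lintegral_ofReal (hsub.integrable_exp_mul _)
            (Filter.Eventually.of_forall fun _ => (Real.exp_pos _).le),
          ← ENNReal.ofReal_mul (integral_nonneg fun _ => (Real.exp_pos _).le)]
        refine ENNReal.ofReal_le_one.2 ?_
        rw [← div_eq_mul_inv, div_le_one (Real.exp_pos _)]
        have := hsub.mgf_le (c (pulls h i))
        rw [mgf] at this
        simpa using this
      · simp
    calc ∫⁻ j, ∫⁻ x, ENNReal.ofReal (expWeight ν G σ i c
          (Fin.snoc (α := fun _ => Fin k × ℝ) h (j, x) : Hist k (t + 1)))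
          ∂(ν j (triggers G h j + G j j)) ∂(π.act t h)
        ≤ ∫⁻ _, ENNReal.ofReal (expWeight ν G σ i c h) ∂(π.act t h) :=
          lintegral_mono fun j => key j
      _ = _ := by simp

/-- Weighted noise of arm `i`, the noise of its `(j + 1)`-st pull being weighted by `c j`. -/
def noiseSum (ν : Fin k → ℕ → Measure ℝ) (G : Matrix (Fin k) (Fin k) ℕ) (i : Fin k)
    (c : ℕ → ℝ) (h : Hist k t) : ℝ :=
  ∑ s : Fin t, if (h s).1 = i then c (pullIndex h i s - 1) * noise ν G h s else 0

/-- Chernoff bound for the weighted noise at a fixed exponential parameter `r`. -/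
theorem histLaw_lt_noiseSum_le_exp {ν : Fin k → ℕ → Measure ℝ}
    (hν : ∀ i n, IsProbabilityMeasure (ν i n)) {G : Matrix (Fin k) (Fin k) ℕ} {σ : ℝ≥0}
    (hR : IsRising ν G T σ) (π : Policy k) (i : Fin k) {c : ℕ → ℝ} {n : ℕ}
    (hc : ∀ j, n ≤ j → c j = 0) (ht : t ≤ T) {r b V : ℝ} (hr : 0 ≤ r)
    (hV : ∑ j ∈ range n, c j ^ 2 ≤ V) :
    histLaw ν G π t {h | b < noiseSum ν G i c h} ≤
      ENNReal.ofReal (Real.exp (σ ^ 2 * r ^ 2 * V / 2 - r * b)) := by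
  have h1 := lintegral_expWeight_le hν hR π i (fun j => r * c j) ht
  have hsub : {h : Hist k t | b < noiseSum ν G i c h} ⊆
      {h | ENNReal.ofReal (Real.exp (r * b - σ ^ 2 * r ^ 2 * V / 2)) ≤
        ENNReal.ofReal (expWeight ν G σ i (fun j => r * c j) h)} := by
    intro h hh
    refine ENNReal.ofReal_le_ofReal (Real.exp_le_exp.2 ?_)
    have h2 : ∑ s : Fin t, (if (h s).1 = i then
        r * c (pullIndex h i s - 1) * noise ν G h s
          - σ ^ 2 * (r * c (pullIndex h i s - 1)) ^ 2 / 2 else 0) =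
        r * noiseSum ν G i c h - σ ^ 2 * r ^ 2 / 2 *
          ∑ s : Fin t, (if (h s).1 = i then c (pullIndex h i s - 1) ^ 2 else 0) := by
      rw [noiseSum, mul_sum, mul_sum, ← sum_sub_distrib]
      refine sum_congr rfl fun s _ => ?_
      split_ifs <;> ring
    rw [h2]
    have h3 := sum_pullIndex_le h i (n := n) (fun j => c j ^ 2) (fun _ => sq_nonneg _)
      fun l hl => Or.inl (by simp [hc l hl])
    have h4 : r * b ≤ r * noiseSum ν G i c h := mul_le_mul_of_nonneg_left (le_of_lt hh) hr
    have h5 := mul_le_mul_of_nonneg_left (h3.trans hV)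
      (show (0 : ℝ) ≤ σ ^ 2 * r ^ 2 / 2 by positivity)
    linarith
  refine (measure_mono hsub).trans ?_
  refine (meas_ge_le_lintegral_div
    (measurable_expWeight ν G σ i _).ennreal_ofReal.aemeasurable
    (by simp [Real.exp_pos]) ENNReal.ofReal_ne_top).trans ?_
  refine (ENNReal.div_le_div_right h1 _).trans ?_
  rw [one_div, ← ENNReal.ofReal_inv_of_pos (Real.exp_pos _), ← Real.exp_neg]
  refine ENNReal.ofReal_le_ofReal (Real.exp_le_exp.2 (le_of_eq (by ring)))

/-- Subgaussian tail of the weighted noise, `L` being the logarithm of the inverse confidence. -/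
theorem histLaw_lt_noiseSum_le {ν : Fin k → ℕ → Measure ℝ}
    (hν : ∀ i n, IsProbabilityMeasure (ν i n)) {G : Matrix (Fin k) (Fin k) ℕ} {σ : ℝ≥0}
    (hR : IsRising ν G T σ) (π : Policy k) (i : Fin k) {c : ℕ → ℝ} {n : ℕ}
    (hc : ∀ j, n ≤ j → c j = 0) (ht : t ≤ T) {L V : ℝ} (hL : 0 ≤ L) (hVpos : 0 < V)
    (hV : ∑ j ∈ range n, c j ^ 2 ≤ V) :
    histLaw ν G π t {h | σ * √(2 * V * L) < noiseSum ν G i c h} ≤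
      ENNReal.ofReal (Real.exp (-L)) := by
  rcases eq_or_ne σ 0 with rfl | hσ
  · -- without noise, the bound `exp (-r b)` holds for all `r` and `b`, so the weighted noise is
    -- almost surely nonpositive
    have h0 : histLaw ν G π t {h | (0 : ℝ) < noiseSum ν G i c h} = 0 := by
      have hU : {h : Hist k t | (0 : ℝ) < noiseSum ν G i c h} =
          ⋃ m : ℕ, {h | 1 / ((m : ℝ) + 1) < noiseSum ν G i c h} := by
        ext h
        simp only [Set.mem_ofPred_eq, Set.mem_iUnion]
        exact ⟨fun hp => exists_nat_one_div_lt hp,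
          fun ⟨m, hm⟩ => lt_trans (by positivity) hm⟩
      rw [hU]
      refine measure_iUnion_null fun m => ?_
      refine le_antisymm ?_ zero_le
      have hlim : Filter.Tendsto (fun r : ℝ => ENNReal.ofReal (Real.exp (-(r * (1 / ((m : ℝ) + 1))))))
          Filter.atTop (nhds 0) := by
        rw [← ENNReal.ofReal_zero]
        refine ENNReal.tendsto_ofReal ?_
        exact Real.tendsto_exp_neg_atTop_nhds_zero.comp
          (Filter.tendsto_id.atTop_mul_const (by positivity))
      refine ge_of_tendsto hlim ?_
      filter_upwards [Filter.eventually_ge_atTop 0] with r hr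
      have := histLaw_lt_noiseSum_le_exp hν hR π i hc ht (b := 1 / ((m : ℝ) + 1)) hr hV
      simpa using this
    simp [h0]
  · have hσ' : (0 : ℝ) < σ := by exact_mod_cast pos_iff_ne_zero.2 hσ
    have hsq : √(2 * V * L) ^ 2 = 2 * V * L := Real.sq_sqrt (by positivity)
    refine (histLaw_lt_noiseSum_le_exp hν hR π i hc ht
      (r := √(2 * V * L) / (σ * V)) (by positivity) hV).trans ?_
    refine ENNReal.ofReal_le_ofReal (Real.exp_le_exp.2 (le_of_eq ?_))
    have : (σ : ℝ) ^ 2 * (√(2 * V * L) / (σ * V)) ^ 2 * V / 2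
        - √(2 * V * L) / (σ * V) * (σ * √(2 * V * L)) = - (√(2 * V * L) ^ 2 / (2 * V)) := by
      field_simp; ring
    rw [this, hsq]
    field_simp

/-- Two-sided version of the tail bound. -/
theorem histLaw_lt_abs_noiseSum_le {ν : Fin k → ℕ → Measure ℝ}
    (hν : ∀ i n, IsProbabilityMeasure (ν i n)) {G : Matrix (Fin k) (Fin k) ℕ} {σ : ℝ≥0}
    (hR : IsRising ν G T σ) (π : Policy k) (i : Fin k) {c : ℕ → ℝ} {n : ℕ}
    (hc : ∀ j, n ≤ j → c j = 0) (ht : t ≤ T) {L V : ℝ} (hL : 0 ≤ L) (hVpos : 0 < V)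
    (hV : ∑ j ∈ range n, c j ^ 2 ≤ V) :
    histLaw ν G π t {h | σ * √(2 * V * L) < |noiseSum ν G i c h|} ≤
      2 * ENNReal.ofReal (Real.exp (-L)) := by
  have h1 := histLaw_lt_noiseSum_le hν hR π i hc ht hL hVpos hV
  have h2 := histLaw_lt_noiseSum_le hν hR π i (c := fun j => - c j) (n := n)
    (fun j hj => by simp [hc j hj]) ht hL hVpos (by simpa using hV)
  have h3 : ∀ h : Hist k t, noiseSum ν G i (fun j => - c j) h = - noiseSum ν G i c h := by
    intro h
    rw [noiseSum, noiseSum, ← sum_neg_distrib]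
    refine sum_congr rfl fun s _ => ?_
    split_ifs <;> simp
  rw [two_mul (ENNReal.ofReal _)]
  refine (measure_mono ?_).trans ((measure_union_le _ _).trans (add_le_add h1 h2))
  intro h hh
  rcases lt_abs.1 (show _ < |noiseSum ν G i c h| from hh) with hp | hp
  · exact Or.inl hp
  · refine Or.inr ?_
    simp only [Set.mem_ofPred_eq, h3]
    exact hp

/-! ### The estimator as a linear functional of the rewards -/

/-- Average over the last `w` of `N` samples `z 1, …, z N` of their linear extrapolations to the
time `t + 1`; the estimator of an arm is the extrapolation of its rewards. -/
def extrapolate (w N t : ℕ) (z : ℕ → ℝ) : ℝ :=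
  (1 / (w : ℝ)) * ∑ l ∈ Finset.Icc (N - w + 1) N,
    (z l + (((t + 1 : ℕ) : ℝ) - l) * ((z l - z (l - w)) / w))

theorem estimator_eq_extrapolate (w : ℕ) (h : Hist k t) (i : Fin k) :
    estimator w h i = extrapolate w (pulls h i) t (nthReward h i) := rfl

theorem extrapolate_sub (w N t : ℕ) (y z : ℕ → ℝ) :
    extrapolate w N t y - extrapolate w N t z = extrapolate w N t fun l => y l - z l := by
  rw [extrapolate, extrapolate, extrapolate, ← mul_sub, ← sum_sub_distrib]
  congr 1
  refine sum_congr rfl fun l _ => ?_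
  ring

theorem sum_Icc_last {w N : ℕ} (hw : w ≤ N) (f : ℕ → ℝ) :
    ∑ l ∈ Finset.Icc (N - w + 1) N, f l = ∑ m ∈ range w, f (N - w + m + 1) := by
  rw [← Finset.Ico_add_one_right_eq_Icc, Finset.sum_Ico_eq_sum_range]
  have : N + 1 - (N - w + 1) = w := by omega
  rw [this]
  exact sum_congr rfl fun m _ => congrArg f (by omega)

/-- Slope factor of the `m`-th sample of the window: its distance to the time `t + 1`, in units of
the window. -/
def slope (w A t m : ℕ) : ℝ := ((t : ℝ) - A - w - m) / w

/-- Weight of the sample `j + 1` among `A + w + w` samples in `extrapolate`. -/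
def weight (w A t j : ℕ) : ℝ :=
  if j < A then 0
  else if j < A + w then -(slope w A t (j - A) / w)
  else if j < A + w + w then (1 + slope w A t (j - (A + w))) / w
  else 0

theorem weight_of_lt {w A j : ℕ} (t : ℕ) (hj : j < A) : weight w A t j = 0 := if_pos hj

theorem weight_add {w A m : ℕ} (t : ℕ) (hm : m < w) :
    weight w A t (A + m) = -(slope w A t m / w) := by
  rw [weight, if_neg (by omega), if_pos (by omega), Nat.add_sub_cancel_left]

theorem weight_add_add {w A m : ℕ} (t : ℕ) (hm : m < w) :
    weight w A t (A + w + m) = (1 + slope w A t m) / w := by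
  rw [weight, if_neg (by omega), if_neg (by omega), if_pos (by omega), Nat.add_sub_cancel_left]

theorem weight_of_le {w A j : ℕ} (t : ℕ) (hj : A + w + w ≤ j) : weight w A t j = 0 := by
  rw [weight, if_neg (by omega), if_neg (by omega), if_neg (by omega)]

theorem sum_range_weight (w A : ℕ) (f : ℕ → ℝ) :
    ∑ j ∈ range (A + w + w), f j = ∑ j ∈ range A, f j +
      (∑ m ∈ range w, f (A + m) + ∑ m ∈ range w, f (A + w + m)) := by
  rw [sum_range_add, sum_range_add, add_assoc]

theorem extrapolate_eq_sum (w A t : ℕ) (z : ℕ → ℝ) :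
    extrapolate w (A + w + w) t z =
      ∑ j ∈ range (A + w + w), weight w A t j * z (j + 1) := by
  rw [extrapolate, sum_Icc_last (by omega), sum_range_weight, mul_sum]
  have h0 : ∑ j ∈ range A, weight w A t j * z (j + 1) = 0 :=
    sum_eq_zero fun j hj => by rw [weight_of_lt t (mem_range.1 hj), zero_mul]
  rw [h0, zero_add, ← sum_add_distrib]
  refine sum_congr rfl fun m hm => ?_
  have hm' := mem_range.1 hm
  rw [weight_add t hm', weight_add_add t hm', Nat.add_sub_cancel]
  have h1 : A + w + m + 1 - w = A + m + 1 := by omega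
  rw [h1, slope]
  push_cast
  ring

/-- The constant `5 = 1 + 2 ^ 2` is the one behind the factor `10` in the exploration bonus: as
`t - A - w ≥ w`, the slopes are at most `R = (t - A - w) / w`, and `1 + R ≤ 2 R`. -/
theorem sum_weight_sq_le {w A t : ℕ} (hw : 0 < w) (ht : A + w + w ≤ t) :
    ∑ j ∈ range (A + w + w), weight w A t j ^ 2 ≤
      5 * ((t : ℝ) - A - w) ^ 2 / (w : ℝ) ^ 3 := by
  have hw' : (0 : ℝ) < w := by exact_mod_cast hw
  have ht' : (A : ℝ) + w + w ≤ t := by exact_mod_cast ht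
  rw [sum_range_weight]
  have h0 : ∑ j ∈ range A, weight w A t j ^ 2 = 0 :=
    sum_eq_zero fun j hj => by rw [weight_of_lt t (mem_range.1 hj)]; ring
  rw [h0, zero_add, ← sum_add_distrib]
  set R : ℝ := ((t : ℝ) - A - w) / w with hR
  have hR1 : 1 ≤ R := by rw [hR, le_div_iff₀ hw']; linarith
  have hterm : ∀ m ∈ range w,
      weight w A t (A + m) ^ 2 + weight w A t (A + w + m) ^ 2 ≤ 5 * R ^ 2 / (w : ℝ) ^ 2 := by
    intro m hm
    have hm' := mem_range.1 hm
    have hmw : (m : ℝ) ≤ w := by exact_mod_cast hm'.le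
    rw [weight_add t hm', weight_add_add t hm']
    have hs0 : 0 ≤ slope w A t m := div_nonneg (by linarith) hw'.le
    have hs1 : slope w A t m ≤ R :=
      div_le_div_of_nonneg_right (by linarith [(Nat.cast_nonneg m : (0 : ℝ) ≤ m)]) hw'.le
    have : (-(slope w A t m / w)) ^ 2 + ((1 + slope w A t m) / w) ^ 2 =
        (slope w A t m ^ 2 + (1 + slope w A t m) ^ 2) / (w : ℝ) ^ 2 := by
      field_simp
    rw [this]
    refine div_le_div_of_nonneg_right ?_ (by positivity)
    nlinarith
  calc _ ≤ ∑ _m ∈ range w, 5 * R ^ 2 / (w : ℝ) ^ 2 := sum_le_sum hterm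
    _ = _ := by rw [sum_const, card_range, nsmul_eq_mul, hR]; field_simp

/-- Conditional expectation of the reward of the `l`-th pull of `i`. -/
def nthMean (ν : Fin k → ℕ → Measure ℝ) (G : Matrix (Fin k) (Fin k) ℕ) (h : Hist k t)
    (i : Fin k) : ℕ → ℝ :=
  atPull h i fun s => mean ν (h s).1 (internalTime G h s)

theorem estimator_sub_eq_noiseSum (ν : Fin k → ℕ → Measure ℝ) (G : Matrix (Fin k) (Fin k) ℕ)
    (h : Hist k t) (i : Fin k) {w A : ℕ} (hN : pulls h i = A + w + w) :
    estimator w h i - extrapolate w (pulls h i) t (nthMean ν G h i) =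
      noiseSum ν G i (weight w A t) h := by
  have h1 : (fun l => nthReward h i l - nthMean ν G h i l) = atPull h i (noise ν G h) := by
    funext l
    rw [nthReward_eq, nthMean, atPull_sub]; rfl
  rw [estimator_eq_extrapolate, extrapolate_sub, h1, hN, extrapolate_eq_sum, ← hN,
    sum_mul_atPull]
  rfl

/-- Histories after which the estimator of some arm deviates from the extrapolation of its means by
more than the exploration bonus. -/
def deviationSet (ν : Fin k → ℕ → Measure ℝ) (G : Matrix (Fin k) (Fin k) ℕ) (σ : ℝ≥0)
    (ε α : ℝ) (t : ℕ) : Set (Hist k t) :=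
  {h | ∃ i, window ε h i ≠ 0 ∧
    bonus σ (window ε h i) (((t + 1 : ℕ) : ℝ) ^ (-α)) h i <
      |estimator (window ε h i) h i -
        extrapolate (window ε h i) (pulls h i) t (nthMean ν G h i)|}

theorem log_one_div_rpow_neg (t : ℕ) (α : ℝ) :
    Real.log (1 / ((t + 1 : ℕ) : ℝ) ^ (-α)) = α * Real.log ((t + 1 : ℕ) : ℝ) := by
  have : (0 : ℝ) < ((t + 1 : ℕ) : ℝ) := by positivity
  rw [Real.rpow_neg this.le, one_div, inv_inv, Real.log_rpow this]

theorem two_mul_floor_le {ε : ℝ} (h0 : 0 < ε) (h1 : ε < 1 / 2) (N : ℕ) :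
    2 * ⌊ε * (N : ℝ)⌋₊ ≤ N := by
  have h2 := Nat.floor_le (show 0 ≤ ε * (N : ℝ) by positivity)
  have h3 : (2 * ⌊ε * (N : ℝ)⌋₊ : ℝ) ≤ N := by
    nlinarith [(Nat.cast_nonneg N : (0 : ℝ) ≤ N)]
  exact_mod_cast h3

/-- The probability of a deviation, by a union bound over the arms and their numbers of pulls. -/
theorem histLaw_deviationSet_le {ν : Fin k → ℕ → Measure ℝ}
    (hν : ∀ i n, IsProbabilityMeasure (ν i n)) {G : Matrix (Fin k) (Fin k) ℕ} {σ : ℝ≥0}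
    (hR : IsRising ν G T σ) (π : Policy k) {ε α : ℝ} (hε : 0 < ε) (hε' : ε < 1 / 2)
    (hα : 0 ≤ α) (ht : t ≤ T) :
    histLaw ν G π t (deviationSet ν G σ ε α t) ≤
      ENNReal.ofReal (2 * k * ((t + 1 : ℕ) : ℝ) ^ (1 - α)) := by
  have htpos : (0 : ℝ) < ((t + 1 : ℕ) : ℝ) := by positivity
  set p : ENNReal := 2 * ENNReal.ofReal (((t + 1 : ℕ) : ℝ) ^ (-α)) with hp
  set S : Fin k → ℕ → Set (Hist k t) := fun i N =>
    {h | pulls h i = N ∧ ⌊ε * (N : ℝ)⌋₊ ≠ 0 ∧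
      bonus σ ⌊ε * (N : ℝ)⌋₊ (((t + 1 : ℕ) : ℝ) ^ (-α)) h i <
        |estimator ⌊ε * (N : ℝ)⌋₊ h i -
          extrapolate ⌊ε * (N : ℝ)⌋₊ (pulls h i) t (nthMean ν G h i)|} with hS
  have hsub : deviationSet ν G σ ε α t ⊆
      ⋃ i ∈ (univ : Finset (Fin k)), ⋃ N ∈ range (t + 1), S i N := by
    rintro h ⟨i, hi⟩
    simp only [Set.mem_iUnion]
    exact ⟨i, mem_univ _, pulls h i,
      mem_range.2 (Nat.lt_succ_of_le (pulls_le h i)), rfl, hi⟩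
  have hSp : ∀ i, ∀ N ∈ range (t + 1), histLaw ν G π t (S i N) ≤ p := by
    intro i N hN
    have hNt : N ≤ t := Nat.lt_succ_iff.1 (mem_range.1 hN)
    set w := ⌊ε * (N : ℝ)⌋₊ with hw
    by_cases hw0 : w = 0
    · have : S i N = ∅ := by
        rw [Set.eq_empty_iff_forall_notMem]
        rintro h ⟨_, h2, _⟩
        exact h2 hw0
      rw [this, measure_empty]
      exact zero_le
    have hwpos : 0 < w := Nat.pos_of_ne_zero hw0
    have hwpos' : (0 : ℝ) < w := by exact_mod_cast hwpos
    have h2w := two_mul_floor_le hε hε' N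
    rw [← hw] at h2w
    obtain ⟨A, hA⟩ : ∃ A, N = A + w + w := ⟨N - 2 * w, by omega⟩
    have hAt : (A : ℝ) + w + w ≤ t := by exact_mod_cast hA ▸ hNt
    have hApos : (0 : ℝ) < (t : ℝ) - A - w := by linarith
    have hlog : 0 ≤ α * Real.log ((t + 1 : ℕ) : ℝ) :=
      mul_nonneg hα (Real.log_natCast_nonneg _)
    have hmain := histLaw_lt_abs_noiseSum_le hν hR π i (c := weight w A t) (n := A + w + w)
      (fun j hj => weight_of_le t hj) ht hlog
      (V := 5 * ((t : ℝ) - A - w) ^ 2 / (w : ℝ) ^ 3) (by positivity)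
      (sum_weight_sq_le hwpos (hA ▸ hNt))
    have hexp : Real.exp (-(α * Real.log ((t + 1 : ℕ) : ℝ))) = ((t + 1 : ℕ) : ℝ) ^ (-α) := by
      rw [Real.rpow_def_of_pos htpos]; ring_nf
    rw [hexp] at hmain
    refine (measure_mono ?_).trans hmain
    rintro h ⟨h1, -, h3⟩
    rw [estimator_sub_eq_noiseSum ν G h i (h1.trans hA)] at h3
    refine lt_of_eq_of_lt ?_ h3
    have hNc : (N : ℝ) = A + w + w := by exact_mod_cast hA
    have hV : 2 * (5 * ((t : ℝ) - A - w) ^ 2 / (w : ℝ) ^ 3) * (α * Real.log ((t + 1 : ℕ) : ℝ)) =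
        ((t : ℝ) - A - w) ^ 2 * (10 * (α * Real.log ((t + 1 : ℕ) : ℝ)) / (w : ℝ) ^ 3) := by
      ring
    rw [hV, Real.sqrt_mul (sq_nonneg _), Real.sqrt_sq hApos.le, bonus, log_one_div_rpow_neg, h1,
      ← hw, hNc]
    push_cast
    ring
  calc histLaw ν G π t (deviationSet ν G σ ε α t)
      ≤ ∑ i : Fin k, ∑ N ∈ range (t + 1), histLaw ν G π t (S i N) := by
        refine (measure_mono hsub).trans ((measure_biUnion_finset_le _ _).trans ?_)
        exact sum_le_sum fun i _ => measure_biUnion_finset_le _ _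
    _ ≤ ∑ _i : Fin k, ∑ _N ∈ range (t + 1), p :=
        sum_le_sum fun i _ => sum_le_sum fun N hN => hSp i N hN
    _ = ENNReal.ofReal (2 * k * ((t + 1 : ℕ) : ℝ) ^ (1 - α)) := by
        rw [sum_const, sum_const, card_range, card_univ, Fintype.card_fin, nsmul_eq_mul,
          nsmul_eq_mul, hp, sub_eq_add_neg, Real.rpow_add htpos, Real.rpow_one,
          ENNReal.ofReal_mul (by positivity), ENNReal.ofReal_mul (by positivity),
          ENNReal.ofReal_mul (by positivity), ENNReal.ofReal_natCast, ENNReal.ofReal_natCast]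
        simp only [ENNReal.ofReal_ofNat]
        ring

/-! ### Optimism and the regret of a single round -/

variable {ν : Fin k → ℕ → Measure ℝ} {G : Matrix (Fin k) (Fin k) ℕ} {σ : ℝ≥0}

theorem IsRising.incr_antitone (hR : IsRising ν G T σ) (i : Fin k) {a b : ℕ} (ha : 1 ≤ a)
    (hab : a ≤ b) (hb : b < T) : incr ν i b ≤ incr ν i a := by
  induction b, hab using Nat.le_induction with
  | base => exact le_rfl
  | succ n hn ih => exact (hR.concave i n (by omega) hb).trans (ih (by omega))

theorem IsRising.mean_mono (hR : IsRising ν G T σ) (i : Fin k) {a b : ℕ} (ha : 1 ≤ a)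
    (hab : a ≤ b) (hb : b ≤ T) : mean ν i a ≤ mean ν i b := by
  induction b, hab using Nat.le_induction with
  | base => exact le_rfl
  | succ n hn ih =>
    have := hR.nondecreasing i n (by omega) (by omega)
    rw [incr] at this
    linarith [ih (by omega)]

theorem IsRising.mean_sub_le (hR : IsRising ν G T σ) (i : Fin k) {n a b : ℕ} (hn : 1 ≤ n)
    (hna : n ≤ a) (hab : a ≤ b) (hb : b ≤ T) :
    mean ν i b - mean ν i a ≤ ((b : ℝ) - a) * incr ν i n := by
  induction b, hab using Nat.le_induction with
  | base => simp
  | succ m hm ih =>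
    have h1 := hR.incr_antitone i hn (hna.trans hm) (by omega)
    have h2 := ih (by omega)
    rw [incr] at h1
    push_cast
    linarith

theorem IsRising.le_mean_sub (hR : IsRising ν G T σ) (i : Fin k) {n a b : ℕ} (ha : 1 ≤ a)
    (hab : a ≤ b) (hbn : b ≤ n + 1) (hn : n < T) :
    ((b : ℝ) - a) * incr ν i n ≤ mean ν i b - mean ν i a := by
  induction b, hab using Nat.le_induction with
  | base => simp
  | succ m hm ih =>
    have h1 := hR.incr_antitone i (show 1 ≤ m by omega) (show m ≤ n by omega) hn
    have h2 := ih (by omega)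
    rw [show incr ν i m = mean ν i (m + 1) - mean ν i m from rfl] at h1
    push_cast
    linarith

/-- The trigger counts `τ 1 < τ 2 < …` of an arm at its successive pulls. -/
theorem exists_pullTimes (hR : IsRising ν G T σ) (h : Hist k t) (i : Fin k) :
    ∃ τ : ℕ → ℕ, (∀ l, 1 ≤ l → l ≤ pulls h i →
        nthMean ν G h i l = mean ν i (τ l) ∧ l ≤ τ l ∧ τ l ≤ triggers G h i) ∧
      ∀ l l', 1 ≤ l → l ≤ l' → l' ≤ pulls h i → τ l + l' ≤ τ l' + l := by
  have hex : ∀ l, ∃ s : ℕ, ∀ (_ : 1 ≤ l) (_ : l ≤ pulls h i),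
      ∃ hs : s < t, (h ⟨s, hs⟩).1 = i ∧ pullIndex h i ⟨s, hs⟩ = l := by
    intro l
    by_cases hl : 1 ≤ l ∧ l ≤ pulls h i
    · obtain ⟨s, h1, h2⟩ := exists_pullIndex_eq h i hl.1 hl.2
      exact ⟨s, fun _ _ => ⟨s.2, h1, h2⟩⟩
    · exact ⟨0, fun h1 h2 => absurd ⟨h1, h2⟩ hl⟩
  choose r hr using hex
  refine ⟨fun l => if hs : r l < t then internalTime G h ⟨r l, hs⟩ else 0, ?_, ?_⟩
  · intro l h1 h2
    obtain ⟨hs, ha, hl⟩ := hr l h1 h2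
    simp only [dif_pos hs]
    refine ⟨?_, ?_, ?_⟩
    · conv_lhs => rw [← hl]
      rw [nthMean, atPull_pullIndex h i _ ha, ha]
    · conv_lhs => rw [← hl]
      exact pullIndex_le_internalTime hR.diag h i ha
    · have := internalTime_le_triggers G h ⟨r l, hs⟩
      rwa [ha] at this
  · intro l l' h1 h2 h3
    obtain ⟨hs, ha, hl⟩ := hr l h1 (h2.trans h3)
    obtain ⟨hs', ha', hl'⟩ := hr l' (h1.trans h2) h3
    simp only [dif_pos hs, dif_pos hs']
    have hle : (⟨r l, hs⟩ : Fin t) ≤ ⟨r l', hs'⟩ := by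
      by_contra hlt
      have := pullIndex_strictMono h i (not_le.1 hlt) ha
      omega
    have := internalTime_add_le hR.diag h i hle ha ha'
    omega

/-- Optimism: by concavity, the extrapolation of the means overestimates the mean of the arm even
if all rounds had triggered it. -/
theorem mean_le_extrapolate (hR : IsRising ν G T σ) (h : Hist k t) (i : Fin k) (ht : t + 1 ≤ T)
    {w : ℕ} (hw : 0 < w) (h2w : 2 * w ≤ pulls h i) :
    mean ν i (t + 1) ≤ extrapolate w (pulls h i) t (nthMean ν G h i) := by
  obtain ⟨τ, hτ, hτ'⟩ := exists_pullTimes hR h i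
  have hw' : (0 : ℝ) < w := by exact_mod_cast hw
  have htr := triggers_le hR.entries h i
  have key : ∀ l ∈ Finset.Icc (pulls h i - w + 1) (pulls h i), mean ν i (t + 1) ≤
      nthMean ν G h i l + (((t + 1 : ℕ) : ℝ) - l) *
        ((nthMean ν G h i l - nthMean ν G h i (l - w)) / w) := by
    intro l hl
    have hl := mem_Icc.1 hl
    obtain ⟨e1, e2, e3⟩ := hτ l (by omega) (by omega)
    obtain ⟨f1, f2, f3⟩ := hτ (l - w) (by omega) (by omega)
    have hd := hτ' (l - w) l (by omega) (by omega) (by omega)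
    rw [e1, f1]
    -- the increment just before the `l`-th pull lies below the slope over the window, and above
    -- all later increments
    have hg0 := hR.nondecreasing i (τ l - 1) (by omega) (by omega)
    have h1 := hR.le_mean_sub i (n := τ l - 1) (a := τ (l - w)) (b := τ l) (by omega) (by omega)
      (by omega) (by omega)
    have h2 : mean ν i (t + 1) - mean ν i (τ l) ≤
        (((t + 1 : ℕ) : ℝ) - τ l) * incr ν i (τ l - 1) := by
      refine (hR.mean_sub_le i (n := τ l) (by omega) le_rfl (by omega) ht).trans ?_
      refine mul_le_mul_of_nonneg_left
        (hR.incr_antitone i (by omega) (by omega) (by omega)) ?_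
      rw [sub_nonneg]; exact_mod_cast (by omega : τ l ≤ t + 1)
    have h3 : incr ν i (τ l - 1) ≤ (mean ν i (τ l) - mean ν i (τ (l - w))) / w := by
      rw [le_div_iff₀ hw', mul_comm]
      refine (mul_le_mul_of_nonneg_right ?_ hg0).trans h1
      rw [le_sub_iff_add_le]; exact_mod_cast (by omega : w + τ (l - w) ≤ τ l)
    have h4 : (0 : ℝ) ≤ ((t + 1 : ℕ) : ℝ) - l := by
      rw [sub_nonneg]; exact_mod_cast (by omega : l ≤ t + 1)
    have h5 : ((t + 1 : ℕ) : ℝ) - τ l ≤ ((t + 1 : ℕ) : ℝ) - l := by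
      have : (l : ℝ) ≤ τ l := by exact_mod_cast e2
      linarith
    have h6 := mul_le_mul_of_nonneg_right h5 hg0
    have h7 := mul_le_mul_of_nonneg_left h3 h4
    linarith
  have hsum := sum_le_sum key
  rw [sum_const, Nat.card_Icc, nsmul_eq_mul] at hsum
  have hcard : pulls h i + 1 - (pulls h i - w + 1) = w := by omega
  rw [hcard] at hsum
  rw [extrapolate, one_div, ← div_eq_inv_mul, le_div_iff₀ hw', mul_comm]
  exact hsum

/-- The bias of the extrapolation: the slopes are controlled by the increment at any trigger count
`n` that precedes the window. -/
theorem extrapolate_le (hR : IsRising ν G T σ) (h : Hist k t) (i : Fin k) (ht : t + 1 ≤ T)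
    {w n : ℕ} (hw : 0 < w) (h2w : 2 * w ≤ pulls h i) (hn : 1 ≤ n)
    (hn' : n ≤ pulls h i - 2 * w + 1) (hnT : n < T) :
    extrapolate w (pulls h i) t (nthMean ν G h i) ≤
      mean ν i (triggers G h i + 1) + (T : ℝ) ^ 2 * incr ν i n / w := by
  obtain ⟨τ, hτ, hτ'⟩ := exists_pullTimes hR h i
  have hw' : (0 : ℝ) < w := by exact_mod_cast hw
  have htr := triggers_le hR.entries h i
  have hg0 := hR.nondecreasing i n hn hnT
  have key : ∀ l ∈ Finset.Icc (pulls h i - w + 1) (pulls h i),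
      nthMean ν G h i l + (((t + 1 : ℕ) : ℝ) - l) *
        ((nthMean ν G h i l - nthMean ν G h i (l - w)) / w) ≤
      mean ν i (triggers G h i + 1) + (T : ℝ) ^ 2 * incr ν i n / w := by
    intro l hl
    have hl := mem_Icc.1 hl
    obtain ⟨e1, e2, e3⟩ := hτ l (by omega) (by omega)
    obtain ⟨f1, f2, f3⟩ := hτ (l - w) (by omega) (by omega)
    have hd := hτ' (l - w) l (by omega) (by omega) (by omega)
    rw [e1, f1]
    have h1 := hR.mean_mono i (show 1 ≤ τ l by omega)
      (show τ l ≤ triggers G h i + 1 by omega) (by omega)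
    have h2 := hR.mean_sub_le i hn (a := τ (l - w)) (b := τ l) (by omega) (by omega) (by omega)
    have h3 : mean ν i (τ l) - mean ν i (τ (l - w)) ≤ T * incr ν i n := by
      refine h2.trans (mul_le_mul_of_nonneg_right ?_ hg0)
      have : (τ l : ℝ) ≤ T := by exact_mod_cast (by omega : τ l ≤ T)
      linarith [(Nat.cast_nonneg (τ (l - w)) : (0 : ℝ) ≤ _)]
    have h4 : (0 : ℝ) ≤ ((t + 1 : ℕ) : ℝ) - l := by
      rw [sub_nonneg]; exact_mod_cast (by omega : l ≤ t + 1)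
    have h5 : ((t + 1 : ℕ) : ℝ) - l ≤ T := by
      have : ((t + 1 : ℕ) : ℝ) ≤ T := by exact_mod_cast ht
      linarith [(Nat.cast_nonneg l : (0 : ℝ) ≤ _)]
    have h6 : (((t + 1 : ℕ) : ℝ) - l) * ((mean ν i (τ l) - mean ν i (τ (l - w))) / w) ≤
        T * (T * incr ν i n / w) :=
      (mul_le_mul_of_nonneg_left (div_le_div_of_nonneg_right h3 hw'.le) h4).trans
        (mul_le_mul_of_nonneg_right h5 (by positivity))
    have h7 : (T : ℝ) * (T * incr ν i n / w) = (T : ℝ) ^ 2 * incr ν i n / w := by ring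
    linarith
  have hsum := sum_le_sum key
  rw [sum_const, Nat.card_Icc, nsmul_eq_mul] at hsum
  have hcard : pulls h i + 1 - (pulls h i - w + 1) = w := by omega
  rw [hcard] at hsum
  rw [extrapolate, one_div, ← div_eq_inv_mul, div_le_iff₀ hw', mul_comm]
  exact hsum

theorem bonus_le {α : ℝ} (hα : 0 ≤ α) (h : Hist k t) (i : Fin k) (ht : t + 1 ≤ T) {w : ℕ}
    (h2w : 2 * w ≤ pulls h i) :
    bonus σ w (((t + 1 : ℕ) : ℝ) ^ (-α)) h i ≤
      σ * T * √(10 * (α * Real.log T) / (w : ℝ) ^ 3) := by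
  rw [bonus, log_one_div_rpow_neg]
  have h1 : Real.log ((t + 1 : ℕ) : ℝ) ≤ Real.log T :=
    Real.log_le_log (by positivity) (by exact_mod_cast ht)
  have h2 : ((t + 1 : ℕ) : ℝ) - pulls h i + w - 1 ≤ T := by
    have h3 : ((t + 1 : ℕ) : ℝ) ≤ T := by exact_mod_cast ht
    have h4 : (w : ℝ) ≤ pulls h i := by exact_mod_cast (by omega : w ≤ pulls h i)
    linarith
  have h5 : √(10 * (α * Real.log ((t + 1 : ℕ) : ℝ)) / (w : ℝ) ^ 3) ≤
      √(10 * (α * Real.log T) / (w : ℝ) ^ 3) := by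
    refine Real.sqrt_le_sqrt (div_le_div_of_nonneg_right ?_ (by positivity))
    nlinarith
  refine mul_le_mul (mul_le_mul_of_nonneg_left h2 σ.2) h5 (Real.sqrt_nonneg _) (by positivity)

/-- Regret of a round without deviation in which an arm of maximal finite index is played. -/
theorem round_regret_le (hR : IsRising ν G T σ) {ε α : ℝ} (hε : 0 < ε) (hε' : ε < 1 / 2)
    (hα : 0 ≤ α) {h : Hist k t} (ht : t + 1 ≤ T) (hdev : h ∉ deviationSet ν G σ ε α t)
    {i : Fin k} (hmax : ∀ j, ucb σ ε α h j ≤ ucb σ ε α h i) (hw : window ε h i ≠ 0) {n : ℕ}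
    (hn : 1 ≤ n) (hn' : n ≤ pulls h i - 2 * window ε h i + 1) (hnT : n < T) (j : Fin k) :
    mean ν j (t + 1) - mean ν i (triggers G h i + 1) ≤
      (T : ℝ) ^ 2 * incr ν i n / (window ε h i) +
        2 * (σ * T * √(10 * (α * Real.log T) / (window ε h i : ℝ) ^ 3)) := by
  have hfin : ∀ j, window ε h j ≠ 0 → |estimator (window ε h j) h j -
        extrapolate (window ε h j) (pulls h j) t (nthMean ν G h j)| ≤
          bonus σ (window ε h j) (((t + 1 : ℕ) : ℝ) ^ (-α)) h j := by
    intro j hj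
    by_contra hc
    exact hdev ⟨j, hj, not_le.1 hc⟩
  have hle := hmax j
  have hwj : window ε h j ≠ 0 := by
    intro h0
    rw [ucb, ucb, if_pos h0, if_neg hw, top_le_iff] at hle
    exact EReal.coe_ne_top _ hle
  rw [ucb, ucb, if_neg hwj, if_neg hw, EReal.coe_le_coe_iff] at hle
  have h1 := mean_le_extrapolate hR h j ht (Nat.pos_of_ne_zero hwj) (two_mul_floor_le hε hε' _)
  have h2 := extrapolate_le hR h i ht (Nat.pos_of_ne_zero hw) (two_mul_floor_le hε hε' _) hn hn' hnT
  have h3 := bonus_le (σ := σ) hα h i ht (w := window ε h i) (two_mul_floor_le hε hε' _)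
  have h4 := abs_le.1 (hfin j hwj)
  have h5 := abs_le.1 (hfin i hw)
  linarith [h4.1, h5.2]

/-! ### From increments to the total increment -/

theorem ceil_div_le (T d : ℕ) : ⌈(T : ℝ) / (d : ℝ)⌉₊ ≤ T := by
  rw [Nat.ceil_le]
  rcases Nat.eq_zero_or_pos d with rfl | hd
  · simp
  · exact div_le_self (Nat.cast_nonneg T) (by exact_mod_cast hd)

theorem totalIncrement_nonneg (hR : IsRising ν G T σ) {M : ℕ} (hM : M ≤ T) (q : ℝ) :
    0 ≤ totalIncrement ν M q := by
  refine sum_nonneg fun n hn => Real.iSup_nonneg fun i => Real.rpow_nonneg ?_ _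
  have := mem_Ico.1 hn
  exact hR.nondecreasing i n this.1 (by omega)

/-- Since the increments are non-increasing, the total increment controls each of them. -/
theorem mul_incr_rpow_le_totalIncrement (hR : IsRising ν G T σ) (i : Fin k) {M n : ℕ}
    (hM : M ≤ T) (hn : n < M) {q : ℝ} (hq : 0 ≤ q) :
    (n : ℝ) * incr ν i n ^ q ≤ totalIncrement ν M q := by
  have h1 : (n : ℝ) * incr ν i n ^ q = ∑ _m ∈ Finset.Ico 1 (n + 1), incr ν i n ^ q := by
    rw [sum_const, Nat.card_Ico, nsmul_eq_mul, Nat.add_sub_cancel]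
  rw [h1, totalIncrement]
  refine (sum_le_sum fun m hm => ?_).trans
    (sum_le_sum_of_subset_of_nonneg (Finset.Ico_subset_Ico_right hn) fun m hm _ => ?_)
  · have hm := mem_Ico.1 hm
    refine le_trans ?_ (le_ciSup (f := fun i => incr ν i m ^ q) (Set.finite_range _).bddAbove i)
    exact Real.rpow_le_rpow (hR.nondecreasing i n (by omega) (by omega))
      (hR.incr_antitone i hm.1 (by omega) (by omega)) hq
  · have hm := mem_Ico.1 hm
    exact Real.iSup_nonneg fun i =>
      Real.rpow_nonneg (hR.nondecreasing i m hm.1 (by omega)) _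

theorem min_one_le_rpow {x p : ℝ} (hx : 0 ≤ x) (hp : 0 ≤ p) (hp1 : p ≤ 1) :
    min 1 x ≤ x ^ p := by
  rcases le_total 1 x with h | h
  · exact (min_le_left _ _).trans (Real.one_le_rpow h hp)
  · rcases hx.eq_or_lt with rfl | hx0
    · exact (min_le_right _ _).trans (Real.rpow_nonneg le_rfl _)
    · refine (min_le_right _ _).trans ?_
      conv_lhs => rw [← Real.rpow_one x]
      exact Real.rpow_le_rpow_of_exponent_ge hx0 h hp1

/-- Contribution of a clique to the regret bound, per arm and up to constants and logarithms. -/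
def cliqueRate (ν : Fin k → ℕ → Measure ℝ) (T : ℕ) (q : ℝ) (D : Finset (Fin k)) : ℝ :=
  (T : ℝ) ^ (2 * q / (1 + q)) *
    totalIncrement ν ⌈(T : ℝ) / (D.card : ℝ)⌉₊ q ^ (1 / (1 + q))

theorem cliqueRate_nonneg (hR : IsRising ν G T σ) (q : ℝ) (D : Finset (Fin k)) :
    0 ≤ cliqueRate ν T q D :=
  mul_nonneg (Real.rpow_nonneg (Nat.cast_nonneg T) _)
    (Real.rpow_nonneg (totalIncrement_nonneg hR (ceil_div_le T _) q) _)

/-- The extrapolation bias is interpolated between the trivial bound `1` and its value with exponent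
`q / (1 + q)`; the remaining power of `u` is supplied by the decay `incr n ^ q ≤ Υ / n`. -/
theorem min_one_bias_le (hR : IsRising ν G T σ) (i : Fin k) {q : ℝ} (hq : 0 ≤ q)
    (D : Finset (Fin k)) {n w : ℕ} (hn : 1 ≤ n) (hnM : n < ⌈(T : ℝ) / (D.card : ℝ)⌉₊)
    {u : ℝ} (hu : 1 / (n : ℝ) ≤ u) (hwu : 1 / (w : ℝ) ≤ u) :
    min 1 ((T : ℝ) ^ 2 * incr ν i n / w) ≤ cliqueRate ν T q D * u := by
  have hMT := ceil_div_le T D.card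
  set M := ⌈(T : ℝ) / (D.card : ℝ)⌉₊ with hM
  have hg : 0 ≤ incr ν i n := hR.nondecreasing i n hn (by omega)
  have hn0 : (0 : ℝ) < n := by exact_mod_cast hn
  have hu0 : 0 < u := lt_of_lt_of_le (by positivity) hu
  have hq1 : (0 : ℝ) < 1 + q := by linarith
  have hΥ := totalIncrement_nonneg hR hMT q
  have h1 : incr ν i n ^ q ≤ totalIncrement ν M q * u := by
    have h2 := mul_incr_rpow_le_totalIncrement hR i hMT hnM hq
    calc incr ν i n ^ q = (n * incr ν i n ^ q) * (1 / n) := by field_simp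
      _ ≤ totalIncrement ν M q * u :=
        mul_le_mul h2 hu (by positivity) hΥ
  have h3 : incr ν i n ^ (q / (1 + q)) ≤ totalIncrement ν M q ^ (1 / (1 + q)) *
      u ^ (1 / (1 + q)) := by
    rw [← Real.mul_rpow hΥ hu0.le]
    have : q / (1 + q) = q * (1 / (1 + q)) := by ring
    rw [this, Real.rpow_mul hg]
    exact Real.rpow_le_rpow (Real.rpow_nonneg hg _) h1 (by positivity)
  have h4 : (1 / (w : ℝ)) ^ (q / (1 + q)) ≤ u ^ (q / (1 + q)) :=
    Real.rpow_le_rpow (by positivity) hwu (by positivity)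
  have h5 : ((T : ℝ) ^ 2) ^ (q / (1 + q)) = (T : ℝ) ^ (2 * q / (1 + q)) := by
    rw [← Real.rpow_natCast, ← Real.rpow_mul (Nat.cast_nonneg T)]
    congr 1
    push_cast
    ring
  have h6 : u ^ (1 / (1 + q)) * u ^ (q / (1 + q)) = u := by
    rw [← Real.rpow_add hu0]
    have : 1 / (1 + q) + q / (1 + q) = 1 := by field_simp
    rw [this, Real.rpow_one]
  refine (min_one_le_rpow (by positivity) (p := q / (1 + q)) (by positivity) ?_).trans ?_
  · rw [div_le_one hq1]; linarith
  calc ((T : ℝ) ^ 2 * incr ν i n / w) ^ (q / (1 + q))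
      = (T : ℝ) ^ (2 * q / (1 + q)) * incr ν i n ^ (q / (1 + q)) *
          (1 / (w : ℝ)) ^ (q / (1 + q)) := by
        rw [div_eq_mul_one_div, Real.mul_rpow (by positivity) (by positivity),
          Real.mul_rpow (by positivity) hg, h5]
    _ ≤ (T : ℝ) ^ (2 * q / (1 + q)) *
          (totalIncrement ν M q ^ (1 / (1 + q)) * u ^ (1 / (1 + q))) * u ^ (q / (1 + q)) := by
        have := Real.rpow_nonneg hΥ (1 / (1 + q))
        refine mul_le_mul (mul_le_mul_of_nonneg_left h3 (by positivity)) h4 (by positivity)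
          (by positivity)
    _ = (T : ℝ) ^ (2 * q / (1 + q)) * totalIncrement ν M q ^ (1 / (1 + q)) *
          (u ^ (1 / (1 + q)) * u ^ (q / (1 + q))) := by ring
    _ = _ := by rw [h6]; rfl

theorem min_one_bonus_le {S Q : ℝ} (hS : 0 ≤ S) (hQ : 0 ≤ Q) (w : ℕ) :
    min 1 (2 * (S * √(Q / (w : ℝ) ^ 3))) ≤ 2 * S ^ ((2 : ℝ) / 3) * (1 + Q) * (1 / w) := by
  refine (min_one_le_rpow (by positivity) (p := 2 / 3) (by norm_num) (by norm_num)).trans ?_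
  have h1 : √(Q / (w : ℝ) ^ 3) ^ ((2 : ℝ) / 3) = Q ^ ((1 : ℝ) / 3) * (1 / w) := by
    rw [Real.sqrt_eq_rpow, ← Real.rpow_mul (by positivity), Real.div_rpow hQ (by positivity),
      ← Real.rpow_natCast, ← Real.rpow_mul (by positivity)]
    norm_num
    rfl
  have h2 : Q ^ ((1 : ℝ) / 3) ≤ 1 + Q :=
    calc Q ^ ((1 : ℝ) / 3) ≤ (1 + Q) ^ ((1 : ℝ) / 3) :=
          Real.rpow_le_rpow hQ (by linarith) (by norm_num)
      _ ≤ (1 + Q) ^ (1 : ℝ) :=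
          Real.rpow_le_rpow_of_exponent_le (by linarith) (by norm_num)
      _ = 1 + Q := Real.rpow_one _
  have h3 : (2 : ℝ) ^ ((2 : ℝ) / 3) ≤ 2 := by
    conv_rhs => rw [← Real.rpow_one 2]
    exact Real.rpow_le_rpow_of_exponent_le (by norm_num) (by norm_num)
  rw [Real.mul_rpow (by norm_num) (by positivity), Real.mul_rpow hS (by positivity), h1]
  calc (2 : ℝ) ^ ((2 : ℝ) / 3) * (S ^ ((2 : ℝ) / 3) * (Q ^ ((1 : ℝ) / 3) * (1 / w)))
      ≤ 2 * (S ^ ((2 : ℝ) / 3) * ((1 + Q) * (1 / w))) := by gcongr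
    _ = _ := by ring

/-! ### Summation over the rounds -/

/-- Factor of the bias in the regret of a round. -/
def biasConst (ε : ℝ) : ℝ := 4 / ε + 1 / (1 - 2 * ε) + 2

/-- Factor of the exploration bonus in the regret of a round. -/
def bonusConst (ε α : ℝ) : ℝ := 2 * (1 + 10 * α) * (4 / ε)

theorem biasConst_pos {ε : ℝ} (hε : 0 < ε) (hε' : ε < 1 / 2) : 0 < biasConst ε := by
  have : 0 < 1 - 2 * ε := by linarith
  unfold biasConst; positivity

theorem le_min_one_add_min_one {x a b : ℝ} (hx : x ≤ 1) (hab : x ≤ a + b) (ha : 0 ≤ a)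
    (hb : 0 ≤ b) : x ≤ min 1 a + min 1 b := by
  rcases min_choice 1 a with hc | hc <;> rcases min_choice 1 b with hc' | hc' <;>
    rw [hc, hc'] <;> linarith

theorem one_le_of_floor_eq_zero {ε : ℝ} (hε : 0 < ε) (hε' : ε < 1 / 2) {N : ℕ}
    (hw : ⌊ε * (N : ℝ)⌋₊ = 0) : 1 ≤ 4 / ε * (1 / ((N + 1 : ℕ) : ℝ)) := by
  have h1 : ε * (N : ℝ) < 1 := Nat.floor_eq_zero.1 hw
  rw [div_mul_div_comm, mul_one, one_le_div (by positivity)]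
  push_cast
  linarith

theorem one_div_floor_le {ε : ℝ} (hε : 0 < ε) (hε' : ε < 1 / 2) {N : ℕ}
    (hw : ⌊ε * (N : ℝ)⌋₊ ≠ 0) :
    1 / (⌊ε * (N : ℝ)⌋₊ : ℝ) ≤ 4 / ε * (1 / ((N + 1 : ℕ) : ℝ)) := by
  have h1 : ε * N < ⌊ε * (N : ℝ)⌋₊ + 1 := Nat.lt_floor_add_one _
  have hw1 : (1 : ℝ) ≤ ⌊ε * (N : ℝ)⌋₊ := by exact_mod_cast Nat.one_le_iff_ne_zero.2 hw
  rw [div_mul_div_comm, mul_one, div_le_div_iff₀ (by linarith) (by positivity)]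
  push_cast
  linarith

/-- The trigger count at which the bias is evaluated precedes the window and is smaller than `M`,
but of the order of the smaller of the two. -/
theorem one_div_min_le {ε : ℝ} (hε : 0 < ε) (hε' : ε < 1 / 2) {N M : ℕ} (hM : 2 ≤ M) :
    1 / ((min (N - 2 * ⌊ε * (N : ℝ)⌋₊ + 1) (M - 1) : ℕ) : ℝ) ≤
      1 / (1 - 2 * ε) * (1 / ((N + 1 : ℕ) : ℝ)) + 2 * (1 / (M : ℝ)) := by
  have hε2 : 0 < 1 - 2 * ε := by linarith
  have h2w := two_mul_floor_le hε hε' N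
  have hM0 : (2 : ℝ) ≤ M := by exact_mod_cast hM
  have p1 : 0 ≤ 1 / (1 - 2 * ε) * (1 / ((N + 1 : ℕ) : ℝ)) := by positivity
  have p2 : 0 ≤ 1 / (M : ℝ) := by positivity
  rcases min_choice (N - 2 * ⌊ε * (N : ℝ)⌋₊ + 1) (M - 1) with hc | hc
  · have h1 : (1 - 2 * ε) * ((N + 1 : ℕ) : ℝ) ≤ ((N - 2 * ⌊ε * (N : ℝ)⌋₊ + 1 : ℕ) : ℝ) := by
      have hwle : (⌊ε * (N : ℝ)⌋₊ : ℝ) ≤ ε * N := Nat.floor_le (by positivity)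
      have h2 : ((N - 2 * ⌊ε * (N : ℝ)⌋₊ + 1 : ℕ) : ℝ) = N - 2 * ⌊ε * (N : ℝ)⌋₊ + 1 := by
        rw [Nat.cast_add, Nat.cast_sub h2w]
        push_cast
        ring
      rw [h2]
      push_cast
      linarith
    have h3 := one_div_le_one_div_of_le (by positivity) h1
    rw [← one_div_mul_one_div] at h3
    rw [hc]
    linarith
  · have h1 : (M : ℝ) / 2 ≤ ((M - 1 : ℕ) : ℝ) := by
      rw [Nat.cast_sub (by omega)]
      push_cast
      linarith
    have h3 := one_div_le_one_div_of_le (by positivity) h1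
    have h4 : 1 / ((M : ℝ) / 2) = 2 * (1 / (M : ℝ)) := by field_simp
    rw [hc]
    linarith

open Classical in
/-- Bound on the regret of a round in terms of the number of pulls of the arm played and of its
clique. -/
theorem round_regret_le_rate (hR : IsRising ν G T σ) {ε α : ℝ} (hε : 0 < ε) (hε' : ε < 1 / 2)
    (hα : 0 ≤ α) {h : Hist k t} (ht : t + 1 ≤ T) {i : Fin k}
    (hmax : ∀ j, ucb σ ε α h j ≤ ucb σ ε α h i) {q : ℝ} (hq : 0 ≤ q) {D : Finset (Fin k)}
    (hD : D.Nonempty) (j : Fin k) :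
    mean ν j (t + 1) - mean ν i (triggers G h i + 1) ≤
      (if h ∈ deviationSet ν G σ ε α t then 1 else 0) +
      (biasConst ε * (1 + cliqueRate ν T q D) *
          (1 / ((pulls h i + 1 : ℕ) : ℝ) + 1 / (⌈(T : ℝ) / (D.card : ℝ)⌉₊ : ℝ)) +
        bonusConst ε α * (((σ : ℝ) * T) ^ ((2 : ℝ) / 3) * (1 + Real.log T)) *
          (1 / ((pulls h i + 1 : ℕ) : ℝ))) := by
  have hB := cliqueRate_nonneg hR q D
  have hK := biasConst_pos hε hε'
  have hlog : 0 ≤ Real.log (T : ℝ) := Real.log_natCast_nonneg T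
  have hε2 : 0 < 1 - 2 * ε := by linarith
  have htr := triggers_le hR.entries h i
  have hT : (0 : ℝ) < T := by exact_mod_cast (by omega : 0 < T)
  have hd : (0 : ℝ) < D.card := by exact_mod_cast hD.card_pos
  have hMpos : 0 < ⌈(T : ℝ) / (D.card : ℝ)⌉₊ := Nat.ceil_pos.2 (by positivity)
  have hMT := ceil_div_le T D.card
  generalize hM : ⌈(T : ℝ) / (D.card : ℝ)⌉₊ = M at hMpos hMT ⊢
  have hM0 : (0 : ℝ) < M := by exact_mod_cast hMpos
  have hle1 : mean ν j (t + 1) - mean ν i (triggers G h i + 1) ≤ 1 := by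
    have h1 := (hR.mean_mem j (t + 1) (by omega) ht).2
    have h2 := (hR.mean_mem i (triggers G h i + 1) (by omega) (by omega)).1
    linarith
  set N := pulls h i with hN
  have hN0 : (0 : ℝ) < ((N + 1 : ℕ) : ℝ) := by positivity
  have hK2 : 0 ≤ bonusConst ε α := by unfold bonusConst; positivity
  have hrest : 0 ≤ bonusConst ε α * (((σ : ℝ) * T) ^ ((2 : ℝ) / 3) * (1 + Real.log T)) *
          (1 / ((N + 1 : ℕ) : ℝ)) := by positivity
  have hmain : 0 ≤ biasConst ε * (1 + cliqueRate ν T q D) *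
          (1 / ((N + 1 : ℕ) : ℝ) + 1 / (M : ℝ)) := by positivity
  by_cases hdev : h ∈ deviationSet ν G σ ε α t
  · rw [if_pos hdev]; linarith
  rw [if_neg hdev, zero_add]
  -- if the arm has not been pulled often enough, or if its clique has at least `T` arms, then the
  -- first summand is at least `1`
  have hsmall : 1 ≤ biasConst ε * (1 / ((N + 1 : ℕ) : ℝ) + 1 / (M : ℝ)) →
      mean ν j (t + 1) - mean ν i (triggers G h i + 1) ≤
        biasConst ε * (1 + cliqueRate ν T q D) * (1 / ((N + 1 : ℕ) : ℝ) + 1 / (M : ℝ)) +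
        bonusConst ε α * (((σ : ℝ) * T) ^ ((2 : ℝ) / 3) * (1 + Real.log T)) *
          (1 / ((N + 1 : ℕ) : ℝ)) := by
    intro h1
    have h2 : 0 ≤ biasConst ε * cliqueRate ν T q D * (1 / ((N + 1 : ℕ) : ℝ) + 1 / (M : ℝ)) := by
      positivity
    have h3 : biasConst ε * (1 + cliqueRate ν T q D) * (1 / ((N + 1 : ℕ) : ℝ) + 1 / (M : ℝ)) =
        biasConst ε * (1 / ((N + 1 : ℕ) : ℝ) + 1 / (M : ℝ)) +
          biasConst ε * cliqueRate ν T q D * (1 / ((N + 1 : ℕ) : ℝ) + 1 / (M : ℝ)) := by ring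
    linarith
  set u := biasConst ε * (1 / ((N + 1 : ℕ) : ℝ) + 1 / (M : ℝ)) with hu
  have hexp : u = 4 / ε * (1 / ((N + 1 : ℕ) : ℝ)) + 1 / (1 - 2 * ε) * (1 / ((N + 1 : ℕ) : ℝ)) +
      2 * (1 / ((N + 1 : ℕ) : ℝ)) + (4 / ε * (1 / (M : ℝ)) + 1 / (1 - 2 * ε) * (1 / (M : ℝ)) +
      2 * (1 / (M : ℝ))) := by rw [hu, biasConst]; ring
  have p1 : 0 ≤ 4 / ε * (1 / ((N + 1 : ℕ) : ℝ)) := by positivity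
  have p2 : 0 ≤ 1 / (1 - 2 * ε) * (1 / ((N + 1 : ℕ) : ℝ)) := by positivity
  have p3 : 0 ≤ 1 / ((N + 1 : ℕ) : ℝ) := by positivity
  have p4 : 0 ≤ 4 / ε * (1 / (M : ℝ)) := by positivity
  have p5 : 0 ≤ 1 / (1 - 2 * ε) * (1 / (M : ℝ)) := by positivity
  have p6 : 0 ≤ 1 / (M : ℝ) := by positivity
  by_cases hw : window ε h i = 0
  · refine hsmall ?_
    have h2 := one_le_of_floor_eq_zero hε hε' hw
    linarith
  by_cases hM1 : M = 1
  · refine hsmall ?_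
    have h2 : 1 / (M : ℝ) = 1 := by rw [hM1]; norm_num
    linarith
  have hwu0 := one_div_floor_le hε hε' hw
  have hnu0 := one_div_min_le hε hε' (N := N) (M := M) (by omega)
  change 1 / (window ε h i : ℝ) ≤ _ at hwu0
  change 1 / ((min (N - 2 * window ε h i + 1) (M - 1) : ℕ) : ℝ) ≤ _ at hnu0
  have hn1 : 1 ≤ min (N - 2 * window ε h i + 1) (M - 1) := le_min (by omega) (by omega)
  have hnM : min (N - 2 * window ε h i + 1) (M - 1) < M :=
    lt_of_le_of_lt (min_le_right _ _) (by omega)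
  have hreg := round_regret_le hR hε hε' hα ht hdev hmax hw hn1 (min_le_left _ _)
    (lt_of_lt_of_le hnM hMT) j
  generalize hn : min (N - 2 * window ε h i + 1) (M - 1) = n at hnu0 hn1 hnM hreg
  generalize window ε h i = w at hwu0 hreg
  have hwu : 1 / (w : ℝ) ≤ u := by linarith
  have hnu : 1 / (n : ℝ) ≤ u := by linarith
  have hX := min_one_bias_le hR i hq D hn1 (hM ▸ hnM) hnu hwu
  have hY := min_one_bonus_le (S := (σ : ℝ) * T) (Q := 10 * (α * Real.log T)) (by positivity)
    (by positivity) w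
  have hX0 : 0 ≤ (T : ℝ) ^ 2 * incr ν i n / w := by
    have := hR.nondecreasing i n hn1 (by omega)
    positivity
  have hY0 : 0 ≤ 2 * ((σ : ℝ) * T * √(10 * (α * Real.log T) / (w : ℝ) ^ 3)) := by positivity
  have hsplit := le_min_one_add_min_one hle1 hreg hX0 hY0
  have hQ : 1 + 10 * (α * Real.log T) ≤ (1 + 10 * α) * (1 + Real.log T) := by linarith
  have hY2 : 2 * ((σ : ℝ) * T) ^ ((2 : ℝ) / 3) * (1 + 10 * (α * Real.log T)) * (1 / w) ≤
      bonusConst ε α * (((σ : ℝ) * T) ^ ((2 : ℝ) / 3) * (1 + Real.log T)) *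
          (1 / ((N + 1 : ℕ) : ℝ)) := by
    calc 2 * ((σ : ℝ) * T) ^ ((2 : ℝ) / 3) * (1 + 10 * (α * Real.log T)) * (1 / w)
        ≤ 2 * ((σ : ℝ) * T) ^ ((2 : ℝ) / 3) * ((1 + 10 * α) * (1 + Real.log T)) *
            (4 / ε * (1 / ((N + 1 : ℕ) : ℝ))) := by gcongr
      _ = _ := by rw [bonusConst]; ring
  have hfac : biasConst ε * (1 + cliqueRate ν T q D) * (1 / ((N + 1 : ℕ) : ℝ) + 1 / (M : ℝ)) =
      u + cliqueRate ν T q D * u := by rw [hu]; ring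
  have hu0 : 0 ≤ u := by positivity
  linarith

theorem sum_one_div_pullIndex_le (h : Hist k T) (F : Fin k → ℝ) (hF : ∀ i, 0 ≤ F i) :
    ∑ s : Fin T, F (h s).1 * (1 / (pullIndex h (h s).1 s : ℝ)) ≤
      (1 + Real.log T) * ∑ i, F i := by
  have h1 : ∀ i, ∑ s : Fin T, (if (h s).1 = i then 1 / ((pullIndex h i s : ℕ) : ℝ) else 0) ≤
      1 + Real.log T := by
    intro i
    have h2 := sum_pullIndex_le h i (n := T) (fun l => 1 / ((l + 1 : ℕ) : ℝ))
      (fun l => by positivity) (fun l hl => Or.inr hl)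
    have h3 := harmonic_le_one_add_log T
    have h4 : ((harmonic T : ℚ) : ℝ) = ∑ l ∈ range T, 1 / ((l + 1 : ℕ) : ℝ) := by
      simp [harmonic]
    rw [h4] at h3
    refine le_trans (le_of_eq ?_) (h2.trans h3)
    refine sum_congr rfl fun s _ => ?_
    split_ifs with hs
    · rw [Nat.sub_add_cancel (one_le_pullIndex h i hs)]
    · rfl
  calc ∑ s : Fin T, F (h s).1 * (1 / (pullIndex h (h s).1 s : ℝ))
      = ∑ i, F i * ∑ s : Fin T, (if (h s).1 = i then 1 / ((pullIndex h i s : ℕ) : ℝ) else 0) := by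
        simp only [mul_sum]
        rw [sum_comm]
        refine sum_congr rfl fun s _ => ?_
        rw [Finset.sum_eq_single (h s).1]
        · rw [if_pos rfl]
        · intro b _ hb; rw [if_neg (Ne.symm hb), mul_zero]
        · simp
    _ ≤ ∑ i, F i * (1 + Real.log T) :=
        sum_le_sum fun i _ => mul_le_mul_of_nonneg_left (h1 i) (hF i)
    _ = _ := by rw [← sum_mul, mul_comm]

theorem sum_part (P : Finpartition (univ : Finset (Fin k))) (f : Finset (Fin k) → ℝ) :
    ∑ i, f (P.part i) = ∑ D ∈ P.parts, (D.card : ℝ) * f D := by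
  rw [← sum_fiberwise_of_maps_to (s := univ) (t := P.parts) (g := fun i => P.part i)
    fun i _ => P.part_mem.2 (mem_univ i)]
  refine sum_congr rfl fun D hD => ?_
  have h1 : univ.filter (fun i => P.part i = D) = D := by
    ext i
    simp only [mem_filter, mem_univ, true_and]
    exact ⟨fun h => h ▸ P.mem_part (mem_univ i), fun h => P.part_eq_of_mem hD h⟩
  rw [sum_congr rfl (fun i hi => by rw [(mem_filter.1 hi).2] :
    ∀ i ∈ univ.filter (fun i => P.part i = D), f (P.part i) = f D), sum_const, h1, nsmul_eq_mul]

theorem sum_part_div_ceil_le (P : Finpartition (univ : Finset (Fin k))) (h : Hist k T)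
    (f : Finset (Fin k) → ℝ) (hf : ∀ D, 0 ≤ f D) :
    ∑ s : Fin T, f (P.part (h s).1) *
        (1 / (⌈(T : ℝ) / ((P.part (h s).1).card : ℝ)⌉₊ : ℝ)) ≤
      ∑ D ∈ P.parts, (D.card : ℝ) * f D := by
  rw [← sum_fiberwise_of_maps_to (s := univ) (t := P.parts) (g := fun s => P.part (h s).1)
    fun s _ => P.part_mem.2 (mem_univ _)]
  refine sum_le_sum fun D hD => ?_
  have hd : (0 : ℝ) < D.card := by exact_mod_cast (P.nonempty_of_mem_parts hD).card_pos
  rw [sum_congr rfl (fun s hs => by rw [(mem_filter.1 hs).2] :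
    ∀ s ∈ univ.filter (fun s => P.part (h s).1 = D), f (P.part (h s).1) *
        (1 / (⌈(T : ℝ) / ((P.part (h s).1).card : ℝ)⌉₊ : ℝ)) =
      f D * (1 / (⌈(T : ℝ) / (D.card : ℝ)⌉₊ : ℝ))), sum_const, nsmul_eq_mul]
  have h1 : ((univ.filter fun s : Fin T => P.part (h s).1 = D).card : ℝ) ≤ T := by
    have := card_filter_le (univ : Finset (Fin T)) fun s => P.part (h s).1 = D
    rw [card_univ, Fintype.card_fin] at this
    exact_mod_cast this
  have h2 : (T : ℝ) * (1 / (⌈(T : ℝ) / (D.card : ℝ)⌉₊ : ℝ)) ≤ D.card := by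
    rw [mul_one_div]
    refine div_le_of_le_mul₀ (Nat.cast_nonneg _) hd.le ?_
    have := Nat.le_ceil ((T : ℝ) / (D.card : ℝ))
    rwa [div_le_iff₀' hd] at this
  calc _ ≤ (T : ℝ) * (f D * (1 / (⌈(T : ℝ) / (D.card : ℝ)⌉₊ : ℝ))) :=
        mul_le_mul_of_nonneg_right h1 (mul_nonneg (hf D) (by positivity))
    _ = f D * ((T : ℝ) * (1 / (⌈(T : ℝ) / (D.card : ℝ)⌉₊ : ℝ))) := by ring
    _ ≤ f D * D.card := mul_le_mul_of_nonneg_left h2 (hf D)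
    _ = _ := mul_comm _ _

/-- Upper bound on the value of all policies: in round `t + 1`, the best arm as if it had been
triggered in all rounds so far. -/
def oracleValue (ν : Fin k → ℕ → Measure ℝ) (T : ℕ) : ℝ :=
  ∑ s : Fin T, ⨆ j, mean ν j (s + 1)

theorem integrable_reward (hν : ∀ i n, IsProbabilityMeasure (ν i n)) (π : Policy k) :
    Integrable (fun h : Hist k T => ∑ s : Fin T, mean ν (h s).1 (internalTime G h s))
      (histLaw ν G π T) := by
  have := isProbabilityMeasure_histLaw hν G π T
  set g : (Fin T → Fin k) → ℝ := fun a =>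
    ∑ s : Fin T, mean ν (a s) (∑ r ∈ univ.filter (fun r => r ≤ s), G (a r) (a s)) with hg
  have hm : Measurable fun h : Hist k T => g fun s => (h s).1 := measurable_of_arms g
  refine Integrable.of_bound (C := ∑ a, |g a|) hm.aestronglyMeasurable
    (Filter.Eventually.of_forall fun h => ?_)
  exact single_le_sum (f := fun a => |g a|) (fun a _ => abs_nonneg _)
    (mem_univ fun s => (h s).1)

theorem value_le_oracleValue (hν : ∀ i n, IsProbabilityMeasure (ν i n))
    (hR : IsRising ν G T σ) (π : Policy k) : value ν G T π ≤ oracleValue ν T := by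
  have := isProbabilityMeasure_histLaw hν G π T
  have h1 : oracleValue ν T = ∫ _h, oracleValue ν T ∂(histLaw ν G π T) := by simp
  rw [h1, value]
  refine integral_mono (integrable_reward hν π) (integrable_const _) fun h => ?_
  refine sum_le_sum fun s _ => ?_
  refine le_trans ?_ (le_ciSup (f := fun j => mean ν j (s + 1)) (Set.finite_range _).bddAbove
    (h s).1)
  exact hR.mean_mono _ (one_le_internalTime hR.diag h s) (internalTime_le hR.entries h s) s.2

theorem collect_terms_le {a b k S Y Λ : ℝ} (ha : 0 ≤ a) (hb : 0 ≤ b) (hk : 0 ≤ k) (hS : 0 ≤ S)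
    (hY : 0 ≤ Y) (hΛ : 1 ≤ Λ) :
    Λ * (a * (k + Y) + k * (b * (S * Λ))) + a * (k + Y) ≤
      (2 * a + b) * Λ ^ 2 * (k + (k * S + Y)) := by
  have hΛ2 : Λ ≤ Λ ^ 2 := le_self_pow₀ hΛ two_ne_zero
  have h0 : 0 ≤ a * (k + Y) := by positivity
  have e1 := mul_le_mul_of_nonneg_right hΛ2 h0
  have e2 := mul_le_mul_of_nonneg_right (hΛ.trans hΛ2) h0
  have e3 : 0 ≤ 2 * a * Λ ^ 2 * (k * S) + b * Λ ^ 2 * (k + Y) := by positivity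
  calc Λ * (a * (k + Y) + k * (b * (S * Λ))) + a * (k + Y)
      = Λ * (a * (k + Y)) + 1 * (a * (k + Y)) + b * Λ ^ 2 * (k * S) := by ring
    _ ≤ Λ ^ 2 * (a * (k + Y)) + Λ ^ 2 * (a * (k + Y)) + b * Λ ^ 2 * (k * S) +
          (2 * a * Λ ^ 2 * (k * S) + b * Λ ^ 2 * (k + Y)) := by linarith
    _ = _ := by ring

open Classical in
/-- Bound on the regret along a history in which all arms played have maximal index. -/
theorem oracleValue_le (hR : IsRising ν G T σ) {ε α : ℝ} (hε : 0 < ε) (hε' : ε < 1 / 2)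
    (hα : 0 ≤ α) (P : Finpartition (univ : Finset (Fin k))) {h : Hist k T}
    (hmax : ∀ (s : Fin T) j,
      ucb σ ε α (truncate s.isLt.le h) j ≤ ucb σ ε α (truncate s.isLt.le h) (h s).1)
    {q : ℝ} (hq : 0 ≤ q) :
    oracleValue ν T ≤ ∑ s : Fin T, mean ν (h s).1 (internalTime G h s) +
      ∑ s : Fin T, (if truncate s.isLt.le h ∈ deviationSet ν G σ ε α s then 1 else 0) +
      (2 * biasConst ε + bonusConst ε α) * (1 + Real.log T) ^ 2 *
        (k + (k * ((σ : ℝ) * T) ^ ((2 : ℝ) / 3) +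
          ∑ D ∈ P.parts, (D.card : ℝ) * cliqueRate ν T q D)) := by
  have hK := biasConst_pos hε hε'
  have hK2 : 0 ≤ bonusConst ε α := by unfold bonusConst; positivity
  have hlog : 0 ≤ Real.log (T : ℝ) := Real.log_natCast_nonneg T
  set S := ((σ : ℝ) * T) ^ ((2 : ℝ) / 3) with hS
  have hS0 : 0 ≤ S := by positivity
  set Λ := 1 + Real.log (T : ℝ) with hΛ
  have hΛ1 : 1 ≤ Λ := by linarith
  set E : Finset (Fin k) → ℝ := fun D => biasConst ε * (1 + cliqueRate ν T q D) with hE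
  have hE0 : ∀ D, 0 ≤ E D := fun D => by
    have := cliqueRate_nonneg hR q D
    positivity
  set Y := ∑ D ∈ P.parts, (D.card : ℝ) * cliqueRate ν T q D with hY
  have hY0 : 0 ≤ Y := sum_nonneg fun D _ =>
    mul_nonneg (Nat.cast_nonneg _) (cliqueRate_nonneg hR q D)
  have hround : ∀ s : Fin T, (⨆ j, mean ν j (s + 1)) ≤
      mean ν (h s).1 (internalTime G h s) +
      (if truncate s.isLt.le h ∈ deviationSet ν G σ ε α s then 1 else 0) +
      ((E (P.part (h s).1) + bonusConst ε α * (S * Λ)) *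
          (1 / (pullIndex h (h s).1 s : ℝ)) +
        E (P.part (h s).1) * (1 / (⌈(T : ℝ) / ((P.part (h s).1).card : ℝ)⌉₊ : ℝ))) := by
    intro s
    have : Nonempty (Fin k) := ⟨(h s).1⟩
    refine ciSup_le fun j => ?_
    have h1 := round_regret_le_rate hR hε hε' hα (h := truncate s.isLt.le h) s.2 (hmax s) hq
      (D := P.part (h s).1) ⟨_, P.mem_part (mem_univ _)⟩ j
    rw [internalTime_eq, hR.diag, pullIndex_eq, if_pos rfl]
    simp only [hE]
    linarith
  have hsum := sum_le_sum fun s (_ : s ∈ (univ : Finset (Fin T))) => hround s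
  simp only [sum_add_distrib] at hsum
  have h1 := sum_one_div_pullIndex_le h
    (fun i => E (P.part i) + bonusConst ε α * (S * Λ)) fun i => by
      have := hE0 (P.part i)
      positivity
  have h2 := sum_part_div_ceil_le P h E hE0
  have h3 : ∑ D ∈ P.parts, (D.card : ℝ) * E D = biasConst ε * (k + Y) := by
    have h4 := sum_part P fun _ => (1 : ℝ)
    simp only [sum_const, card_univ, Fintype.card_fin, nsmul_eq_mul, mul_one] at h4
    rw [h4, hY, ← sum_add_distrib, mul_sum]
    exact sum_congr rfl fun D _ => by simp only [hE]; ring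
  have h5 : ∑ i, (E (P.part i) + bonusConst ε α * (S * Λ)) =
      biasConst ε * (k + Y) + k * (bonusConst ε α * (S * Λ)) := by
    rw [sum_add_distrib, sum_part, h3, sum_const, card_univ, Fintype.card_fin, nsmul_eq_mul]
  rw [h5] at h1
  rw [h3] at h2
  have hfin := collect_terms_le hK.le hK2 (Nat.cast_nonneg k) hS0 hY0 hΛ1
  rw [oracleValue]
  linarith

/-! ### The regret bound -/

/-- Bound on the expected number of rounds with a deviation, per arm. -/
def deviationConst (α : ℝ) : ℝ := 2 * ∑' n : ℕ, ((n + 1 : ℕ) : ℝ) ^ (1 - α)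

theorem sum_deviation_le {α : ℝ} (hα : 2 < α) (T : ℕ) :
    ∑ s : Fin T, 2 * (k : ℝ) * ((s + 1 : ℕ) : ℝ) ^ (1 - α) ≤ k * deviationConst α := by
  have hs : Summable fun n : ℕ => ((n + 1 : ℕ) : ℝ) ^ (1 - α) :=
    (summable_nat_add_iff (f := fun n : ℕ => (n : ℝ) ^ (1 - α)) 1).2
      (Real.summable_nat_rpow.2 (by linarith))
  rw [← mul_sum, Fin.sum_univ_eq_sum_range (fun n => ((n + 1 : ℕ) : ℝ) ^ (1 - α)) T,
    deviationConst]
  have := hs.sum_le_tsum (range T) fun n _ => by positivity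
  have hk : (0 : ℝ) ≤ 2 * k := by positivity
  nlinarith [mul_le_mul_of_nonneg_left this hk]

theorem regret_le (hν : ∀ i n, IsProbabilityMeasure (ν i n)) (hR : IsRising ν G T σ)
    (P : Finpartition (univ : Finset (Fin k))) {π : Policy k} {ε α : ℝ} (hε : 0 < ε)
    (hε' : ε < 1 / 2) (hα : 2 < α) (hπ : IsRBoxUCB σ ε α π) {q : ℝ} (hq : 0 ≤ q) :
    regret ν G T π ≤ k * deviationConst α +
      (2 * biasConst ε + bonusConst ε α) * (1 + Real.log T) ^ 2 *
        (k + (k * ((σ : ℝ) * T) ^ ((2 : ℝ) / 3) +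
          ∑ D ∈ P.parts, (D.card : ℝ) * cliqueRate ν T q D)) := by
  have hprob := isProbabilityMeasure_histLaw hν G π T
  have : Nonempty (Policy k) := ⟨π⟩
  have hsup : (⨆ π' : Policy k, value ν G T π') ≤ oracleValue ν T :=
    ciSup_le fun π' => value_le_oracleValue hν hR π'
  set c := (2 * biasConst ε + bonusConst ε α) * (1 + Real.log T) ^ 2 *
        (k + (k * ((σ : ℝ) * T) ^ ((2 : ℝ) / 3) +
          ∑ D ∈ P.parts, (D.card : ℝ) * cliqueRate ν T q D)) with hc
  -- measurable hulls of the deviation events, of the same probability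
  set A : Fin T → Set (Hist k T) := fun s => truncate s.isLt.le ⁻¹'
    toMeasurable (histLaw ν G π s) (deviationSet ν G σ ε α s) with hA
  have hAm : ∀ s, MeasurableSet (A s) := fun s =>
    measurable_truncate _ (measurableSet_toMeasurable _ _)
  have hAp : ∀ s : Fin T, (histLaw ν G π T).real (A s) ≤
      2 * (k : ℝ) * ((s + 1 : ℕ) : ℝ) ^ (1 - α) := by
    intro s
    refine ENNReal.toReal_le_of_le_ofReal (by positivity) ?_
    rw [hA, ← Measure.map_apply (measurable_truncate _) (measurableSet_toMeasurable _ _),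
      histLaw_map_truncate hν, measure_toMeasurable]
    exact histLaw_deviationSet_le hν hR π hε hε' (by linarith) s.isLt.le
  have hind : ∀ s, Integrable ((A s).indicator (1 : Hist k T → ℝ)) (histLaw ν G π T) :=
    fun s => (integrable_const (1 : ℝ)).indicator (hAm s)
  have hae : ∀ᵐ h ∂(histLaw ν G π T), oracleValue ν T ≤
      ∑ s : Fin T, mean ν (h s).1 (internalTime G h s) +
        ∑ s : Fin T, (A s).indicator (1 : Hist k T → ℝ) h + c := by
    have h1 := ae_all_iff.2 fun s : Fin T => ae_ucb_le (T := T) hν G hπ s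
    filter_upwards [h1] with h hh
    refine (oracleValue_le hR hε hε' (by linarith) P hh hq).trans ?_
    gcongr with s
    split_ifs with hd
    · have : h ∈ A s := subset_toMeasurable _ _ hd
      rw [Set.indicator_of_mem this]; rfl
    · exact Set.indicator_nonneg (fun _ _ => zero_le_one) _
  have hint := integral_mono_ae (integrable_const _)
    (((integrable_reward hν π).add (integrable_finsetSum univ fun s _ => hind s)).add
      (integrable_const c)) hae
  have hsplit : ∫ h, (∑ s : Fin T, mean ν (h s).1 (internalTime G h s) +
        ∑ s : Fin T, (A s).indicator (1 : Hist k T → ℝ) h + c) ∂(histLaw ν G π T) =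
      value ν G T π + ∑ s : Fin T, (histLaw ν G π T).real (A s) + c := by
    have hI : Integrable (fun h => ∑ s : Fin T, mean ν (h s).1 (internalTime G h s) +
        ∑ s : Fin T, (A s).indicator (1 : Hist k T → ℝ) h) (histLaw ν G π T) :=
      (integrable_reward hν π).add (integrable_finsetSum univ fun s _ => hind s)
    rw [integral_add hI (integrable_const c),
      integral_add (integrable_reward hν π) (integrable_finsetSum univ fun s _ => hind s),
      integral_finsetSum _ fun s _ => hind s, value]
    congr 1
    · congr 1
      exact sum_congr rfl fun s _ => integral_indicator_one (hAm s)
    · simp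
  have hint' : oracleValue ν T ≤ value ν G T π + ∑ s : Fin T, (histLaw ν G π T).real (A s) + c := by
    rw [← hsplit]
    refine le_trans (le_of_eq ?_) hint
    simp
  have hdev := (sum_le_sum fun s (_ : s ∈ (univ : Finset (Fin T))) => hAp s).trans
    (sum_deviation_le hα T)
  rw [regret]
  linarith

end GTB

end

theorem theorem3p6 :
    ∃ p : ℕ, ∀ ε α : ℝ, 0 < ε → ε < 1 / 2 → 2 < α → ∃ C : ℝ, 0 < C ∧
      ∀ (k T : ℕ) (ν : Fin k → ℕ → MeasureTheory.Measure ℝ)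
        (_ : ∀ i n, MeasureTheory.IsProbabilityMeasure (ν i n))
        (G : Matrix (Fin k) (Fin k) ℕ) (σ : NNReal) (_ : GTB.IsRising ν G T σ)
        (P : Finpartition (Finset.univ : Finset (Fin k))) (_ : GTB.IsMinimalSuper G P)
        (π : GTB.Policy k) (_ : GTB.IsRBoxUCB σ ε α π),
        GTB.regret ν G T π ≤ C * (1 + Real.log (T : ℝ)) ^ p *
          ((k : ℝ) + ⨅ q : Set.Icc (0 : ℝ) 1,
            ((k : ℝ) * ((σ : ℝ) * (T : ℝ)) ^ ((2 : ℝ) / 3)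
              + (T : ℝ) ^ (q : ℝ) * (GTB.degOneCount G : ℝ) *
                  GTB.totalIncrement ν ⌈(T : ℝ) / (GTB.degOneCount G : ℝ)⌉₊ q
              + (T : ℝ) ^ (2 * (q : ℝ) / (1 + q)) *
                  ∑ D ∈ P.parts, (D.card : ℝ) *
                    GTB.totalIncrement ν ⌈(T : ℝ) / (D.card : ℝ)⌉₊ q ^ (1 / (1 + (q : ℝ))))) := by
  refine ⟨2, fun ε α hε hε' hα => ?_⟩
  have hK := GTB.biasConst_pos hε hε'
  have hK2 : 0 ≤ GTB.bonusConst ε α := by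
    unfold GTB.bonusConst
    have : 0 < α := by linarith
    positivity
  have hZ : 0 ≤ GTB.deviationConst α := by
    have : 0 ≤ ∑' n : ℕ, ((n + 1 : ℕ) : ℝ) ^ (1 - α) := tsum_nonneg fun n => by positivity
    unfold GTB.deviationConst
    positivity
  refine ⟨GTB.deviationConst α + (2 * GTB.biasConst ε + GTB.bonusConst ε α), by positivity, ?_⟩
  intro k T ν hν G σ hR P _ π hπ
  have hΛ : 1 ≤ 1 + Real.log (T : ℝ) := by linarith [Real.log_natCast_nonneg T]
  set Λ := 1 + Real.log (T : ℝ)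
  set C := GTB.deviationConst α + (2 * GTB.biasConst ε + GTB.bonusConst ε α) with hC
  have hCΛ : 0 < C * Λ ^ 2 := by positivity
  rw [← div_le_iff₀' hCΛ, ← sub_le_iff_le_add']
  refine le_ciInf fun q => ?_
  rw [sub_le_iff_le_add', div_le_iff₀' hCΛ]
  have hmain := GTB.regret_le hν hR P hε hε' hα hπ q.2.1
  have hsum : ∑ D ∈ P.parts, (D.card : ℝ) * GTB.cliqueRate ν T q D =
      (T : ℝ) ^ (2 * (q : ℝ) / (1 + q)) * ∑ D ∈ P.parts, (D.card : ℝ) *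
        GTB.totalIncrement ν ⌈(T : ℝ) / (D.card : ℝ)⌉₊ q ^ (1 / (1 + (q : ℝ))) := by
    rw [Finset.mul_sum]
    exact Finset.sum_congr rfl fun D _ => by rw [GTB.cliqueRate]; ring
  have hsum0 : 0 ≤ ∑ D ∈ P.parts, (D.card : ℝ) * GTB.cliqueRate ν T q D :=
    Finset.sum_nonneg fun D _ => mul_nonneg (Nat.cast_nonneg _) (GTB.cliqueRate_nonneg hR q D)
  have hdeg : 0 ≤ (T : ℝ) ^ (q : ℝ) * (GTB.degOneCount G : ℝ) *
      GTB.totalIncrement ν ⌈(T : ℝ) / (GTB.degOneCount G : ℝ)⌉₊ q :=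
    mul_nonneg (by positivity) (GTB.totalIncrement_nonneg hR (GTB.ceil_div_le T _) q)
  rw [← hsum]
  set X := (k : ℝ) + ((k : ℝ) * ((σ : ℝ) * (T : ℝ)) ^ ((2 : ℝ) / 3) +
    ∑ D ∈ P.parts, (D.card : ℝ) * GTB.cliqueRate ν T q D) with hX
  have hkX : (k : ℝ) ≤ X := by
    have : 0 ≤ (k : ℝ) * ((σ : ℝ) * (T : ℝ)) ^ ((2 : ℝ) / 3) := by positivity
    linarith
  have hX0 : 0 ≤ X := (Nat.cast_nonneg k).trans hkX
  calc GTB.regret ν G T π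
      ≤ k * GTB.deviationConst α + (2 * GTB.biasConst ε + GTB.bonusConst ε α) * Λ ^ 2 * X := hmain
    _ ≤ Λ ^ 2 * X * GTB.deviationConst α +
          (2 * GTB.biasConst ε + GTB.bonusConst ε α) * Λ ^ 2 * X := by
        have : X ≤ Λ ^ 2 * X := le_mul_of_one_le_left hX0 (by nlinarith)
        gcongr
        exact hkX.trans this
    _ = C * Λ ^ 2 * X := by rw [hC]; ring
    _ ≤ _ := mul_le_mul_of_nonneg_left (by rw [hX]; linarith) hCΛ.le
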